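/- Let $X$ be a complex Banach space. A (possibly unbounded) linear operator $A$ on $X$ generates a bounded analytic semigroup if there are $\theta\in(0,\pi/2]$ and a family $(S(z))_{z\in\Sigma_\theta\cup\{0\}}$ of bounded operators on $X$, where $\Sigma_\theta=\{z\in\mathbb C\setminus\{0\}:|\arg z|<\theta\}$, such that $S(0)=I$, $S(z+w)=S(z)S(w)$ for $z,w\in\Sigma_\theta$, $z\mapsto S(z)$ is holomorphic on $\Sigma_\theta$, $S(z)x\to x$ as $z\to 0$ in $\Sigma_\theta$ for every $x\in X$, $\sup_{z\in\Sigma_\theta}\|S(z)\|<\infty$, and $A$ is the infinitesimal generator of $(S(t))_{t\ge 0}$. For $1<p<\infty$ and $0<T<\infty$, an operator $B$ on $X$ satisfies $L^p$-maximal regularity on $[0,T)$ if the operator $u\mapsto u'+Bu$ on $L^p([0,T);X)$, with domain $\{u\in W^{1,p}([0,T);X): u(0)=0\}\cap L^p([0,T);D(B))$, is a bijection onto $L^p([0,T);X)$ with bounded inverse. The operator $B$ satisfies maximal regularity if it satisfies $L^p$-maximal regularity on $[0,T)$ for some $1<p<\infty$ and some $0<T<\infty$ (when $-B$ generates a bounded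 analytic semigroup this is known to be equivalent to all such $p$ and $T$). The space $X$ has the maximal regularity property if every $B$ such that $-B$ generates a bounded analytic semigroup on $X$ satisfies maximal regularity. Then neither of the complex sequence spaces $c_0$ and $\ell_1$ has the maximal regularity property; that is, on each of them there is an operator $B$ such that $-B$ generates a bounded analytic semigroup and $B$ fails $L^p$-maximal regularity on $[0,T)$ for all $1<p<\infty$ and all $0<T<\infty$. -/

import Mathlib

open MeasureTheory Filter Topology Set
open scoped ENNReal ZeroAtInfty

namespace MaximalRegularity

variable {X : Type*} [NormedAddCommGroup X] [NormedSpace ℂ X]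

/-- The open sector `{z ≠ 0 : |arg z| < θ}` of the complex plane. -/
def sector (θ : ℝ) : Set ℂ := {z | z ≠ 0 ∧ |z.arg| < θ}

/-- `S` is an analytic semigroup on the sector of half-angle `θ ∈ (0, π/2]`, strongly continuous
at `0` and uniformly bounded on that sector. (The values of `S` off `sector θ ∪ {0}` play no
role.) -/
structure IsBoundedAnalyticSemigroup (θ : ℝ) (S : ℂ → X →L[ℂ] X) : Prop where
  angle_pos : 0 < θ
  angle_le : θ ≤ Real.pi / 2
  map_zero : S 0 = ContinuousLinearMap.id ℂ X
  map_add : ∀ z ∈ sector θ, ∀ w ∈ sector θ, S (z + w) = (S z).comp (S w)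
  analytic : DifferentiableOn ℂ S (sector θ)
  strongly_continuous : ∀ x : X, Tendsto (fun z => S z x) (𝓝[sector θ] 0) (𝓝 x)
  bounded : ∃ M : ℝ, ∀ z ∈ sector θ, ‖S z‖ ≤ M

/-- `A` is the infinitesimal generator of `(S t)_{t ≥ 0}`: its graph consists of exactly the pairs
`(x, y)` with `(S t x - x) / t → y` as `t → 0+`. -/
def IsGenerator (A : X →ₗ.[ℂ] X) (S : ℂ → X →L[ℂ] X) : Prop :=
  ∀ x y : X, (x, y) ∈ A.graph ↔
    Tendsto (fun t : ℝ => (t : ℂ)⁻¹ • (S (t : ℂ) x - x)) (𝓝[>] (0 : ℝ)) (𝓝 y)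

/-- `A` generates a bounded analytic semigroup on `X`. -/
def GeneratesBoundedAnalyticSemigroup (A : X →ₗ.[ℂ] X) : Prop :=
  ∃ (θ : ℝ) (S : ℂ → X →L[ℂ] X), IsBoundedAnalyticSemigroup θ S ∧ IsGenerator A S

/-- The space `L^p([0,T); X)`. -/
abbrev LpTime (X : Type*) [NormedAddCommGroup X] (p : ℝ≥0∞) (T : ℝ) : Type _ :=
  Lp X p (volume.restrict (Ico (0 : ℝ) T))

/-- `u ∈ W^{1,p}([0,T); X)` with `u(0) = 0` and `u' = v ∈ L^p([0,T); X)`, that is,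
`u(t) = ∫_0^t v(s) ds` for almost every `t`. -/
def HasDerivZero {p : ℝ≥0∞} {T : ℝ} (u v : LpTime X p T) : Prop :=
  ∀ᵐ t ∂(volume.restrict (Ico (0 : ℝ) T)), u t = ∫ s in (0 : ℝ)..t, v s

/-- `u ∈ L^p([0,T); D(B))` and `w(t) = B(u(t))` almost everywhere, with `w ∈ L^p([0,T); X)`. -/
def HasImage (B : X →ₗ.[ℂ] X) {p : ℝ≥0∞} {T : ℝ} (u w : LpTime X p T) : Prop :=
  ∀ᵐ t ∂(volume.restrict (Ico (0 : ℝ) T)), (u t, w t) ∈ B.graph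

/-- `u` lies in the domain of `d/dt + B` on `L^p([0,T); X)`, that is, in
`W_0^{1,p}([0,T); X) ∩ L^p([0,T); D(B))`, and `u' + B u = f`. -/
def SolvesCauchy (B : X →ₗ.[ℂ] X) {p : ℝ≥0∞} {T : ℝ} (u f : LpTime X p T) : Prop :=
  ∃ v w : LpTime X p T, HasDerivZero u v ∧ HasImage B u w ∧ v + w = f

/-- `L^p`-maximal regularity of `B` on `[0,T)`: the operator `d/dt + B` with domain
`W_0^{1,p}([0,T); X) ∩ L^p([0,T); D(B))` is a bijection onto `L^p([0,T); X)` and its inverse is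
bounded on `L^p([0,T); X)`. -/
def HasLpMaximalRegularity (B : X →ₗ.[ℂ] X) (p : ℝ≥0∞) (T : ℝ) : Prop :=
  (∀ f : LpTime X p T, ∃! u : LpTime X p T, SolvesCauchy B u f) ∧
    ∃ C : ℝ, ∀ u f : LpTime X p T, SolvesCauchy B u f → ‖u‖ ≤ C * ‖f‖

/-- (MR): `L^p`-maximal regularity on `[0,T)` for some `1 < p < ∞` and some `0 < T < ∞`. For
negative generators of bounded analytic semigroups this is the same as for all such `p` and `T`;
the form with "some" makes the failure of (MR) a statement about all `p` and `T`. -/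
def HasMaximalRegularity (B : X →ₗ.[ℂ] X) : Prop :=
  ∃ (p : ℝ≥0∞) (T : ℝ), 1 < p ∧ p < ∞ ∧ 0 < T ∧ HasLpMaximalRegularity B p T

/-- (MRP) for a complex Banach space `X`: every `B` such that `-B` generates a bounded analytic
semigroup on `X` satisfies (MR). -/
def MaximalRegularityProperty (X : Type*) [NormedAddCommGroup X] [NormedSpace ℂ X]
    [CompleteSpace X] : Prop :=
  ∀ B : X →ₗ.[ℂ] X, GeneratesBoundedAnalyticSemigroup (-B) → HasMaximalRegularity B

end MaximalRegularity

/-! Both spaces carry a conditional Schauder basis, and `B` is taken diagonal in it with rapidly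
increasing eigenvalues `rate k`. A multiplier sequence of bounded variation is bounded on any basis,
and `exp (-rate k * z)` has variation at most `‖z‖ / re z`, so `-B` generates a bounded analytic
semigroup (`generatesBoundedAnalyticSemigroup`). Surjectivity of `d/dt + B` is what fails.

If `u' + B u = f`, the `k`-th coordinate of `B u` is `relax (rate k)` of the `k`-th coordinate of
`f`: a low-pass filter with cutoff near `rate k` (`ae_eigenfunctional_eq_relax`). The test functions
are Riesz products `r n = ∏ j < n, (1 + i b j sin (freq j t))`, with increments `Δ n = r (n + 1) - r
n`. Since the frequencies interlace lacunarily with the rates, the filter at `rate k` keeps `Δ j`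
for `j < k` and nearly kills it for `j ≥ k`, up to geometrically small errors.

In `c₀` with the summing basis, take `f = (0, Δ 0, Δ 1, …)`. Coordinate `n + 1` of `f` is `Δ n - Δ
(n + 1)`, and filtering leaves `Δ n`. If these were the coordinates of some `y`, telescoping would
give `y 0 - y (N + 1) ≈ r N - 1`, so `‖r N‖ ^ 2 ≥ 1 + ∑ b j ^ 2 sin (freq j t) ^ 2` would be bounded
in `N`. The choice `b j ^ 2 ~ 1 / j` keeps `Δ n → 0` uniformly while `∑ b j ^ 2 = ∞`.

In `ℓ¹` the coordinates are tail sums. Take `f = ∑ w k (r k - 1) e k`, and let `W n` be the tail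
sums of `w`. Filtering the `n`-th tail sum turns every `r k`, `k ≥ n`, into `r n`, leaving `W n (r n
- 1)`; consecutive differences are the entries of `y`, so `y` in `ℓ¹` forces `∑ W (n + 1) ‖Δ n‖ <
∞`. Here `∑ b j ^ 2 < ∞` keeps `r` bounded, yet `∑ W (n + 1) b n = ∞`.

In both cases a Cantor–Lebesgue argument (`summable_of_ae_bounded_sin_sq`) turns boundedness for
almost every `t` into summability of the coefficients, a contradiction. -/

namespace MaximalRegularity

/-! ### Multipliers of bounded variation on a filtration of projections. -/

section Multipliers

variable {X : Type*} [NormedAddCommGroup X] [NormedSpace ℂ X]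

/-- A null sequence of bounded variation at most `V`. -/
structure IsBVNull (m : ℕ → ℂ) (V : ℝ) : Prop where
  tendsto_zero : Tendsto m atTop (𝓝 0)
  summable : Summable fun n => ‖m n - m (n + 1)‖
  tsum_le : ∑' n, ‖m n - m (n + 1)‖ ≤ V

/-- The majorant telescopes to `V * g 0`. -/
theorem IsBVNull.of_le {m : ℕ → ℂ} {g : ℕ → ℝ} {V : ℝ} (hm : Tendsto m atTop (𝓝 0))
    (hg : Tendsto g atTop (𝓝 0)) (hg0 : g 0 ≤ 1) (hV : 0 ≤ V)
    (h : ∀ n, ‖m n - m (n + 1)‖ ≤ V * (g n - g (n + 1))) : IsBVNull m V := by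
  have hs : HasSum (fun n => V * (g n - g (n + 1))) (V * (g 0 - 0)) := by
    rw [hasSum_iff_tendsto_nat_of_nonneg fun n => (norm_nonneg _).trans (h n)]
    simp_rw [← Finset.mul_sum, Finset.sum_range_sub']
    exact (tendsto_const_nhds.sub hg).const_mul V
  have hsum : Summable fun n => ‖m n - m (n + 1)‖ :=
    Summable.of_nonneg_of_le (fun _ => norm_nonneg _) h hs.summable
  refine ⟨hm, hsum, (hsum.tsum_le_tsum h hs.summable).trans ?_⟩
  rw [hs.tsum_eq]
  nlinarith

/-- A uniformly bounded increasing family of commuting projections that converges strongly to the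
identity, such as the partial sum projections of a Schauder basis. -/
structure IsProjectionFiltration (P : ℕ → X →L[ℂ] X) (K : ℝ) : Prop where
  comp : ∀ m n x, P m (P n x) = P (min m n) x
  norm_le : ∀ n, ‖P n‖ ≤ K
  tendsto : ∀ x, Tendsto (fun n => P n x) atTop (𝓝 x)

/-- The difference `P k - P (k - 1)`, with `P (-1) = 0`. -/
def projDiff (P : ℕ → X →L[ℂ] X) : ℕ → X →L[ℂ] X
  | 0 => P 0
  | k + 1 => P (k + 1) - P k

/-- The operator acting as multiplication by `m k` on the range of `projDiff P k`, written through
summation by parts. -/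
noncomputable def multiplier (P : ℕ → X →L[ℂ] X) (m : ℕ → ℂ) : X →L[ℂ] X :=
  ∑' n, (m n - m (n + 1)) • P n

namespace IsProjectionFiltration

variable {P : ℕ → X →L[ℂ] X} {K : ℝ}

theorem bound_nonneg (h : IsProjectionFiltration P K) : 0 ≤ K :=
  (norm_nonneg _).trans (h.norm_le 0)

theorem projDiff_comp_of_le (h : IsProjectionFiltration P K) {k n : ℕ} (hkn : k ≤ n) (x : X) :
    projDiff P k (P n x) = projDiff P k x := by
  cases k with
  | zero => simp [projDiff, h.comp]
  | succ k => simp [projDiff, h.comp, hkn, (Nat.le_succ k).trans hkn]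

theorem projDiff_comp_of_lt (h : IsProjectionFiltration P K) {k n : ℕ} (hkn : n < k) (x : X) :
    projDiff P k (P n x) = 0 := by
  cases k with
  | zero => omega
  | succ k => simp [projDiff, h.comp, hkn.le, Nat.lt_succ_iff.mp hkn]

theorem sum_projDiff (P : ℕ → X →L[ℂ] X) (n : ℕ) (x : X) :
    ∑ k ∈ Finset.range (n + 1), projDiff P k x = P n x := by
  induction n with
  | zero => simp [projDiff]
  | succ n ih => rw [Finset.sum_range_succ, ih]; simp [projDiff]

/-- The partial sums of the blocks are `P n x`, which converge to `x`. Operator identities thus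
reduce to scalar identities on each block. -/
theorem ext_projDiff (h : IsProjectionFiltration P K) {x y : X}
    (hxy : ∀ k, projDiff P k x = projDiff P k y) : x = y := by
  refine tendsto_nhds_unique (h.tendsto x) ?_
  convert! h.tendsto y using 2 with n
  rw [← sum_projDiff, ← sum_projDiff]
  exact Finset.sum_congr rfl fun k _ => hxy k

theorem norm_term_le (h : IsProjectionFiltration P K) (m : ℕ → ℂ) (n : ℕ) :
    ‖(m n - m (n + 1)) • P n‖ ≤ ‖m n - m (n + 1)‖ * K := by
  rw [norm_smul]
  exact mul_le_mul_of_nonneg_left (h.norm_le n) (norm_nonneg _)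

variable {m : ℕ → ℂ} {V : ℝ}

theorem norm_multiplier_le (h : IsProjectionFiltration P K) (hm : IsBVNull m V) :
    ‖multiplier P m‖ ≤ V * K := by
  refine (tsum_of_norm_bounded (hm.summable.mul_right K).hasSum (h.norm_term_le m)).trans ?_
  rw [tsum_mul_right]
  exact mul_le_mul_of_nonneg_right hm.tsum_le h.bound_nonneg

variable [CompleteSpace X]

theorem summable_multiplier (h : IsProjectionFiltration P K) (hm : IsBVNull m V) :
    Summable fun n => (m n - m (n + 1)) • P n :=
  Summable.of_norm_bounded (hm.summable.mul_right K) (h.norm_term_le m)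

/-- Block `k` sees only the terms with `n ≥ k`, where it absorbs `P n`; the scalars telescope to `m
k` because `m` tends to zero. -/
theorem projDiff_multiplier (h : IsProjectionFiltration P K) (hm : IsBVNull m V) (k : ℕ) (x : X) :
    projDiff P k (multiplier P m x) = m k • projDiff P k x := by
  have h1 : HasSum (fun n => projDiff P k (((m n - m (n + 1)) • P n) x))
      (projDiff P k (multiplier P m x)) :=
    (((h.summable_multiplier hm).hasSum.mapL
      (ContinuousLinearMap.apply ℂ X x))).mapL (projDiff P k)
  refine tendsto_nhds_unique h1.tendsto_sum_nat ?_
  have h2 : ∀ N, ∑ n ∈ Finset.range (k + N), projDiff P k (((m n - m (n + 1)) • P n) x)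
      = (m k - m (k + N)) • projDiff P k x := by
    intro N
    induction N with
    | zero =>
      simp only [add_zero, sub_self, zero_smul]
      refine Finset.sum_eq_zero fun n hn => ?_
      simp [h.projDiff_comp_of_lt (Finset.mem_range.mp hn)]
    | succ N ih =>
      rw [← add_assoc, Finset.sum_range_succ, ih]
      simp only [smul_apply, map_smul,
        h.projDiff_comp_of_le (Nat.le_add_right k N), ← add_smul]
      congr 1
      ring
  rw [← tendsto_add_atTop_iff_nat k]
  simp_rw [add_comm _ k, h2]
  have h3 : Tendsto (fun N => m (k + N)) atTop (𝓝 0) := by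
    simp_rw [add_comm k]
    exact (tendsto_add_atTop_iff_nat k).mpr hm.tendsto_zero
  simpa using! (tendsto_const_nhds.sub h3).smul_const (projDiff P k x)

/-- Multipliers of uniformly bounded variation that converge to `1` coordinatewise converge
strongly to the identity. -/
theorem tendsto_multiplier {ι : Type*} {l : Filter ι} {m : ι → ℕ → ℂ}
    (h : IsProjectionFiltration P K) (hm : ∀ᶠ i in l, IsBVNull (m i) V)
    (h1 : ∀ k, Tendsto (fun i => m i k) l (𝓝 1)) (x : X) :
    Tendsto (fun i => multiplier P (m i) x) l (𝓝 x) := by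
  -- On the range of `P n` the multiplier is a finite sum of scalars times blocks; the uniform bound
  -- `V * K` then extends convergence to all `x` by density.
  have hfin : ∀ n, Tendsto (fun i => multiplier P (m i) (P n x)) l (𝓝 (P n x)) := by
    intro n
    have h2 : Tendsto (fun i => ∑ k ∈ Finset.range (n + 1), m i k • projDiff P k x) l
        (𝓝 (∑ k ∈ Finset.range (n + 1), (1 : ℂ) • projDiff P k x)) :=
      tendsto_finsetSum _ fun k _ => (h1 k).smul_const _
    simp only [one_smul, sum_projDiff] at h2
    refine h2.congr' ?_
    filter_upwards [hm] with i hi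
    refine h.ext_projDiff fun j => ?_
    rw [h.projDiff_multiplier hi, map_sum]
    simp only [map_smul]
    have h3 : ∀ k, projDiff P j (projDiff P k x) = if k = j then projDiff P j x else 0 := by
      intro k
      rcases lt_trichotomy k j with hk | hk | hk
      · cases k with
        | zero => rw [if_neg hk.ne]; exact h.projDiff_comp_of_lt hk x
        | succ k =>
          rw [if_neg hk.ne]
          change projDiff P j (P (k + 1) x - P k x) = 0
          rw [map_sub, h.projDiff_comp_of_lt hk, h.projDiff_comp_of_lt (k.lt_succ_self.trans hk),
            sub_zero]
      · subst hk
        cases k with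
        | zero => simp [projDiff, h.comp]
        | succ k =>
          change projDiff P (k + 1) (P (k + 1) x - P k x) = _
          rw [map_sub, h.projDiff_comp_of_le le_rfl, h.projDiff_comp_of_lt k.lt_succ_self]
          simp
      · cases k with
        | zero => omega
        | succ k =>
          rw [if_neg hk.ne']
          change projDiff P j (P (k + 1) x - P k x) = 0
          rw [map_sub, h.projDiff_comp_of_le hk.le, h.projDiff_comp_of_le (Nat.lt_succ_iff.mp hk),
            sub_self]
    simp only [h3, smul_ite, smul_zero, Finset.sum_ite_eq', Finset.mem_range]
    split_ifs with hj
    · rw [h.projDiff_comp_of_le (Nat.lt_succ_iff.mp hj)]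
    · rw [h.projDiff_comp_of_lt (by omega), smul_zero]
  rw [Metric.tendsto_nhds]
  intro ε hε
  have hVK : Tendsto (fun n => V * K * ‖P n x - x‖ + ‖P n x - x‖) atTop (𝓝 0) := by
    have := tendsto_iff_norm_sub_tendsto_zero.mp (h.tendsto x)
    simpa using (this.const_mul (V * K)).add this
  obtain ⟨n, hn⟩ := (hVK.eventually (gt_mem_nhds (half_pos hε))).exists
  filter_upwards [hm, Metric.tendsto_nhds.mp (hfin n) (ε / 2) (half_pos hε)] with i hi hi2
  rw [dist_eq_norm] at hi2 ⊢
  have e : multiplier P (m i) x - x = (multiplier P (m i) (P n x) - P n x)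
      - multiplier P (m i) (P n x - x) + (P n x - x) := by
    rw [map_sub]; abel
  have h4 : ‖multiplier P (m i) (P n x - x)‖ ≤ V * K * ‖P n x - x‖ :=
    (ContinuousLinearMap.le_opNorm _ _).trans
      (mul_le_mul_of_nonneg_right (h.norm_multiplier_le hi) (norm_nonneg _))
  rw [e]
  refine (norm_add_le _ _).trans_lt ?_
  have h5 := norm_sub_le (multiplier P (m i) (P n x) - P n x) (multiplier P (m i) (P n x - x))
  linarith

end IsProjectionFiltration

end Multipliers

/-! ### Diagonal operators and the analytic semigroups they generate. -/

section DiagonalSemigroup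

theorem hasDerivAt_cexp_mul (z : ℂ) (s : ℝ) :
    HasDerivAt (fun s : ℝ => Complex.exp (-(s * z))) (-z * Complex.exp (-(s * z))) s := by
  have h1 : HasDerivAt (fun s : ℝ => -((s : ℂ) * z)) (-(1 * z)) s :=
    ((Complex.ofRealCLM.hasDerivAt (x := s)).mul_const z).neg
  convert! h1.cexp using 1
  ring

theorem norm_cexp_neg_mul (z : ℂ) (s : ℝ) :
    ‖Complex.exp (-(s * z))‖ = Real.exp (-(s * z.re)) := by
  rw [Complex.norm_exp]
  simp

/-- The derivative of `exp (-s z)` has modulus `‖z‖ exp (-s re z)`, which is `‖z‖ / re z` times the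
rate of decrease of `exp (-s re z)`. The right side therefore telescopes along an increasing
sequence. -/
theorem norm_cexp_sub_cexp_le {z : ℂ} (hz : 0 < z.re) {a b : ℝ} (hab : a ≤ b) :
    ‖Complex.exp (-(a * z)) - Complex.exp (-(b * z))‖ ≤
      ‖z‖ / z.re * (Real.exp (-(a * z.re)) - Real.exp (-(b * z.re))) := by
  have hd : ∀ s : ℝ, HasDerivAt (fun s : ℝ => Complex.exp (-(s * z)))
      (-z * Complex.exp (-(s * z))) s := hasDerivAt_cexp_mul z
  have hd2 : ∀ s : ℝ, HasDerivAt (fun s : ℝ => -(‖z‖ / z.re) * Real.exp (-(s * z.re)))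
      (‖z‖ * Real.exp (-(s * z.re))) s := by
    intro s
    have h1 : HasDerivAt (fun s : ℝ => -(s * z.re)) (-(1 * z.re)) s :=
      ((hasDerivAt_id s).mul_const z.re).neg
    convert! h1.exp.const_mul (-(‖z‖ / z.re)) using 1
    field_simp
  have h1 := intervalIntegral.integral_eq_sub_of_hasDerivAt (a := a) (b := b)
    (fun s _ => hd s) (Continuous.intervalIntegrable (by fun_prop) _ _)
  have h2 := intervalIntegral.integral_eq_sub_of_hasDerivAt (a := a) (b := b)
    (fun s _ => hd2 s) (Continuous.intervalIntegrable (by fun_prop) _ _)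
  rw [norm_sub_rev, ← h1]
  refine (intervalIntegral.norm_integral_le_integral_norm hab).trans (le_of_eq ?_)
  have h3 : ∀ s : ℝ, ‖-z * Complex.exp (-(s * z))‖ = ‖z‖ * Real.exp (-(s * z.re)) := by
    intro s
    rw [norm_mul, norm_neg, norm_cexp_neg_mul]
  simp_rw [h3]
  rw [h2]
  ring

theorem re_pos_of_mem_sector {z : ℂ} (hz : z ∈ sector (Real.pi / 4)) : 0 < z.re := by
  have h := hz.2
  have : |z.arg| < Real.pi / 2 := h.trans (by linarith [Real.pi_pos])
  rcases Complex.abs_arg_lt_pi_div_two_iff.mp this with h | h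
  · exact h
  · exact absurd h hz.1

theorem norm_div_re_le_of_mem_sector {z : ℂ} (hz : z ∈ sector (Real.pi / 4)) :
    ‖z‖ / z.re ≤ 2 := by
  have h0 := re_pos_of_mem_sector hz
  have h1 : Real.cos (Real.pi / 4) ≤ Real.cos z.arg := by
    rw [← Real.cos_abs z.arg]
    exact Real.cos_le_cos_of_nonneg_of_le_pi (abs_nonneg _) (by linarith [Real.pi_pos]) hz.2.le
  rw [Complex.cos_arg hz.1, Real.cos_pi_div_four] at h1
  have h2 : 0 < ‖z‖ := norm_pos_iff.mpr hz.1
  rw [le_div_iff₀ h2] at h1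
  rw [div_le_iff₀ h0]
  have h3 : (1 : ℝ) ≤ √2 := by
    rw [Real.one_le_sqrt]; norm_num
  nlinarith

/-- The exponents of a diagonal semigroup: positive, increasing and at least linearly growing. -/
structure IsExponentSequence (lam : ℕ → ℝ) : Prop where
  mono : Monotone lam
  pos : ∀ n, 0 < lam n
  le : ∀ n : ℕ, (n : ℝ) ≤ lam n

namespace IsExponentSequence

variable {lam : ℕ → ℝ}

theorem tendsto_atTop (h : IsExponentSequence lam) : Tendsto lam atTop atTop :=
  tendsto_atTop_mono h.le tendsto_natCast_atTop_atTop

theorem tendsto_exp (h : IsExponentSequence lam) {r : ℝ} (hr : 0 < r) :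
    Tendsto (fun n => Real.exp (-(lam n * r))) atTop (𝓝 0) :=
  Real.tendsto_exp_neg_atTop_nhds_zero.comp (h.tendsto_atTop.atTop_mul_const hr)

theorem isBVNull_exp (h : IsExponentSequence lam) {z : ℂ} (hz : 0 < z.re) :
    IsBVNull (fun n => Complex.exp (-(lam n * z))) (‖z‖ / z.re) := by
  refine IsBVNull.of_le (g := fun n => Real.exp (-(lam n * z.re))) ?_ (h.tendsto_exp hz) ?_
    (by positivity) fun n => norm_cexp_sub_cexp_le hz (h.mono n.le_succ)
  · rw [tendsto_zero_iff_norm_tendsto_zero]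
    simp_rw [norm_cexp_neg_mul]
    exact h.tendsto_exp hz
  · rw [Real.exp_le_one_iff]
    have := mul_pos (h.pos 0) hz
    linarith

theorem isBVNull_exp_of_mem_sector (h : IsExponentSequence lam) {z : ℂ}
    (hz : z ∈ sector (Real.pi / 4)) : IsBVNull (fun n => Complex.exp (-(lam n * z))) 2 := by
  have := h.isBVNull_exp (re_pos_of_mem_sector hz)
  exact ⟨this.1, this.2, this.3.trans (norm_div_re_le_of_mem_sector hz)⟩

/-- These are the multipliers relating difference quotients of the semigroup to its generator. They
decrease in `n`, so the variation is the first term, at most `1`. -/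
theorem isBVNull_expDiv (h : IsExponentSequence lam) {t : ℝ} (ht : 0 < t) :
    IsBVNull (fun n => (((1 - Real.exp (-(lam n * t))) / (lam n * t) : ℝ) : ℂ)) 1 := by
  have hp : ∀ n, 0 < lam n * t := fun n => mul_pos (h.pos n) ht
  have hlim : Tendsto (fun n => (1 - Real.exp (-(lam n * t))) / (lam n * t)) atTop (𝓝 0) :=
    (tendsto_const_nhds.sub (h.tendsto_exp ht)).div_atTop (h.tendsto_atTop.atTop_mul_const ht)
  have hanti : ∀ n, (1 - Real.exp (-(lam (n + 1) * t))) / (lam (n + 1) * t) ≤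
      (1 - Real.exp (-(lam n * t))) / (lam n * t) := by
    intro n
    -- `(1 - exp (-s)) / s` is the slope of the secant of `exp` between `-s` and `0`, so convexity
    -- makes it decrease in `s`.
    have h1 := convexOn_exp.secant_mono (a := 0) (x := -(lam (n + 1) * t)) (y := -(lam n * t))
      trivial trivial trivial (neg_ne_zero.mpr (hp _).ne')
      (neg_ne_zero.mpr (hp _).ne')
      (by nlinarith [h.mono n.le_succ])
    simp only [Real.exp_zero, sub_zero] at h1
    have e : ∀ n, (Real.exp (-(lam n * t)) - 1) / -(lam n * t) =
        (1 - Real.exp (-(lam n * t))) / (lam n * t) := by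
      intro n
      rw [← neg_div_neg_eq]; simp
    rwa [e, e] at h1
  refine IsBVNull.of_le (g := fun n => (1 - Real.exp (-(lam n * t))) / (lam n * t)) ?_ hlim ?_
    zero_le_one fun n => ?_
  · exact_mod_cast (Complex.continuous_ofReal.tendsto 0).comp hlim
  · rw [div_le_one (hp 0)]
    linarith [Real.add_one_le_exp (-(lam 0 * t))]
  · rw [← Complex.ofReal_sub, Complex.norm_real, Real.norm_eq_abs,
      abs_of_nonneg (sub_nonneg.mpr (hanti n)), one_mul]

end IsExponentSequence

variable {X : Type*} [NormedAddCommGroup X] [NormedSpace ℂ X]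

/-- The semigroup acting as `exp (-lam k z)` on the range of `projDiff P k`. -/
noncomputable def diagSemigroup (P : ℕ → X →L[ℂ] X) (lam : ℕ → ℝ) (z : ℂ) : X →L[ℂ] X :=
  if z = 0 then ContinuousLinearMap.id ℂ X else multiplier P fun n => Complex.exp (-(lam n * z))

/-- The graph of the operator acting as `lam k` on the range of `projDiff P k`. -/
def diagGraph (P : ℕ → X →L[ℂ] X) (lam : ℕ → ℝ) : Submodule ℂ (X × X) where
  carrier := {q | ∀ k, projDiff P k q.2 = (lam k : ℂ) • projDiff P k q.1}
  add_mem' := by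
    intro a b ha hb k
    simp [ha k, hb k]
  zero_mem' := by intro k; simp
  smul_mem' := by
    intro c a ha k
    change projDiff P k (c • a.2) = (lam k : ℂ) • projDiff P k (c • a.1)
    rw [map_smul, map_smul, ha k, smul_comm]

/-- The operator acting as `lam k` on the range of `projDiff P k`, with maximal domain. -/
noncomputable def diagOperator (P : ℕ → X →L[ℂ] X) (lam : ℕ → ℝ) : X →ₗ.[ℂ] X :=
  (diagGraph P lam).toLinearPMap

namespace IsProjectionFiltration

variable {P : ℕ → X →L[ℂ] X} {K : ℝ} {lam : ℕ → ℝ}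

theorem mem_graph_diagOperator (h : IsProjectionFiltration P K) {x y : X} :
    (x, y) ∈ (diagOperator P lam).graph ↔
      ∀ k, projDiff P k y = (lam k : ℂ) • projDiff P k x := by
  rw [diagOperator, Submodule.toLinearPMap_graph_eq]
  · rfl
  · intro q hq hq0
    refine h.ext_projDiff fun k => ?_
    rw [hq k, hq0, map_zero, smul_zero]

theorem mem_graph_neg_diagOperator (h : IsProjectionFiltration P K) {x y : X} :
    (x, y) ∈ (-diagOperator P lam).graph ↔
      ∀ k, projDiff P k y = -(lam k : ℂ) • projDiff P k x := by
  rw [LinearPMap.neg_graph, Submodule.mem_map]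
  constructor
  · rintro ⟨⟨a, b⟩, hab, he⟩ k
    simp only [LinearMap.prodMap_apply, LinearMap.id_coe, id, LinearMap.neg_apply,
      Prod.mk.injEq] at he
    obtain ⟨rfl, rfl⟩ := he
    rw [map_neg, h.mem_graph_diagOperator.mp hab k, neg_smul]
  · intro hk
    refine ⟨(x, -y), h.mem_graph_diagOperator.mpr fun k => ?_, by simp⟩
    rw [map_neg, hk k, neg_smul, neg_neg]

variable [CompleteSpace X]

theorem projDiff_diagSemigroup (h : IsProjectionFiltration P K) (hl : IsExponentSequence lam)
    {z : ℂ} (hz : 0 < z.re) (k : ℕ) (x : X) :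
    projDiff P k (diagSemigroup P lam z x) = Complex.exp (-(lam k * z)) • projDiff P k x := by
  have hz0 : z ≠ 0 := by rintro rfl; simp at hz
  rw [diagSemigroup, if_neg hz0, h.projDiff_multiplier (hl.isBVNull_exp hz)]

/-- On `re z > δ` the defining series is dominated by `2 exp (-n δ) K`; this is the purpose of the
condition `n ≤ lam n`. -/
theorem differentiableOn_diagSemigroup (h : IsProjectionFiltration P K)
    (hl : IsExponentSequence lam) :
    DifferentiableOn ℂ (diagSemigroup P lam) {z | 0 < z.re} := by
  have key : ∀ δ : ℝ, 0 < δ → DifferentiableOn ℂ (diagSemigroup P lam) {z | δ < z.re} := by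
    intro δ hδ
    have hopen : IsOpen {z : ℂ | δ < z.re} := isOpen_lt continuous_const Complex.continuous_re
    have hsum : Summable fun n : ℕ => 2 * Real.exp (-(n * δ)) * K := by
      have : Summable fun n : ℕ => Real.exp (n * -δ) := Real.summable_exp_nat_mul_iff.mpr (by simpa)
      simp_rw [← mul_neg]
      exact (this.mul_left 2).mul_right K
    have := Complex.differentiableOn_tsum_of_summable_norm (U := {z : ℂ | δ < z.re})
      (F := fun n z => (Complex.exp (-(lam n * z)) - Complex.exp (-(lam (n + 1) * z))) • P n) hsum
      (fun n => by fun_prop) hopen ?_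
    · refine this.congr fun z hz => ?_
      have hz0 : z ≠ 0 := by
        rintro rfl
        simp only [mem_ofPred_eq, Complex.zero_re] at hz
        linarith
      rw [diagSemigroup, if_neg hz0]
      rfl
    · intro n z hz
      refine (h.norm_term_le (fun n => Complex.exp (-(lam n * z))) n).trans
        (mul_le_mul_of_nonneg_right ?_ h.bound_nonneg)
      refine (norm_sub_le _ _).trans ?_
      rw [norm_cexp_neg_mul, norm_cexp_neg_mul]
      have hb : ∀ a : ℝ, (n : ℝ) ≤ a → Real.exp (-(a * z.re)) ≤ Real.exp (-(n * δ)) := by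
        intro a ha
        rw [Real.exp_le_exp]
        have h0 : (0 : ℝ) ≤ n := n.cast_nonneg
        have hz' : δ < z.re := hz
        nlinarith
      linarith [hb _ (hl.le n), hb _ ((hl.le n).trans (hl.mono n.le_succ))]
  intro z hz
  have hz' : 0 < z.re := hz
  have hopen : IsOpen {w : ℂ | z.re / 2 < w.re} := isOpen_lt continuous_const Complex.continuous_re
  exact ((key (z.re / 2) (half_pos hz')).differentiableAt
    (hopen.mem_nhds (half_lt_self hz'))).differentiableWithinAt

/-- The angle `π / 4` is a convenient choice: any angle below `π / 2` keeps `‖z‖ / re z`, hence the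
variation, bounded. -/
theorem isBoundedAnalyticSemigroup_diagSemigroup (h : IsProjectionFiltration P K)
    (hl : IsExponentSequence lam) :
    IsBoundedAnalyticSemigroup (Real.pi / 4) (diagSemigroup P lam) where
  angle_pos := by positivity
  angle_le := by linarith [Real.pi_pos]
  map_zero := by simp [diagSemigroup]
  map_add z hz w hw := by
    have hz' := re_pos_of_mem_sector hz
    have hw' := re_pos_of_mem_sector hw
    ext x
    refine h.ext_projDiff fun k => ?_
    rw [ContinuousLinearMap.comp_apply,
      h.projDiff_diagSemigroup hl (by simpa using add_pos hz' hw'),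
      h.projDiff_diagSemigroup hl hz', h.projDiff_diagSemigroup hl hw', smul_smul,
      ← Complex.exp_add]
    congr 2
    ring
  analytic := (h.differentiableOn_diagSemigroup hl).mono fun _ hz => re_pos_of_mem_sector hz
  strongly_continuous x := by
    have h1 : ∀ k, Tendsto (fun z : ℂ => Complex.exp (-(lam k * z)))
        (𝓝[sector (Real.pi / 4)] 0) (𝓝 1) := by
      intro k
      have : Continuous fun z : ℂ => Complex.exp (-(lam k * z)) := by fun_prop
      simpa using (this.tendsto 0).mono_left nhdsWithin_le_nhds
    refine (h.tendsto_multiplier (V := 2) ?_ h1 x).congr' ?_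
    · filter_upwards [self_mem_nhdsWithin] with z hz using hl.isBVNull_exp_of_mem_sector hz
    · filter_upwards [self_mem_nhdsWithin] with z hz
      rw [diagSemigroup, if_neg hz.1]
  bounded := by
    refine ⟨2 * K, fun z hz => ?_⟩
    rw [diagSemigroup, if_neg hz.1]
    exact h.norm_multiplier_le (hl.isBVNull_exp_of_mem_sector hz)

theorem tendsto_expDiv {a : ℝ} (ha : 0 < a) :
    Tendsto (fun t : ℝ => (1 - Real.exp (-(a * t))) / (a * t)) (𝓝[>] 0) (𝓝 1) := by
  have h1 : HasDerivAt (fun t : ℝ => -Real.exp (-(a * t))) a 0 := by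
    have h2 : HasDerivAt (fun t : ℝ => -(a * t)) (-(a * 1)) 0 :=
      ((hasDerivAt_id (0 : ℝ)).const_mul a).neg
    convert! h2.exp.neg using 1
    simp
  have h3 := (hasDerivAt_iff_tendsto_slope.mp h1).mono_left
    (nhdsWithin_mono 0 fun t (ht : 0 < t) => ht.ne')
  have h4 := h3.div_const a
  rw [div_self ha.ne'] at h4
  refine h4.congr' ?_
  filter_upwards [self_mem_nhdsWithin] with t ht
  have ht' : (0 : ℝ) < t := ht
  rw [slope_def_field]
  simp only [mul_zero, neg_zero, Real.exp_zero, sub_zero]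
  field_simp
  ring

/-- On each block the difference quotient is `(1 - exp (-lam k t)) / (lam k t)` times the candidate
`-lam k`. For `x` in the domain it is therefore a bounded-variation multiplier applied to `y`, and
it converges strongly to `y`. Conversely, a limit can be read off block by block. -/
theorem isGenerator_diagOperator (h : IsProjectionFiltration P K) (hl : IsExponentSequence lam) :
    IsGenerator (-diagOperator P lam) (diagSemigroup P lam) := by
  have hquot : ∀ x : X, ∀ k, ∀ t : ℝ, 0 < t →
      projDiff P k ((t : ℂ)⁻¹ • (diagSemigroup P lam (t : ℂ) x - x)) =
        (((1 - Real.exp (-(lam k * t))) / (lam k * t) : ℝ) : ℂ) •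
          (-(lam k : ℂ) • projDiff P k x) := by
    intro x k t ht
    rw [map_smul, map_sub, h.projDiff_diagSemigroup hl (by simpa using ht), smul_smul]
    have ht0 : (t : ℂ) ≠ 0 := by exact_mod_cast ht.ne'
    have hl0 : (lam k : ℂ) ≠ 0 := by exact_mod_cast (hl.pos k).ne'
    have e : (Complex.exp (-(lam k * t)) • projDiff P k x - projDiff P k x) =
        (Complex.exp (-(lam k * t)) - 1) • projDiff P k x := by rw [sub_smul, one_smul]
    rw [e, smul_smul]
    congr 1
    push_cast
    field_simp
    ring
  intro x y
  rw [h.mem_graph_neg_diagOperator]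
  constructor
  · intro hxy
    refine (h.tendsto_multiplier (V := 1) (l := 𝓝[>] (0 : ℝ))
      (m := fun t n => (((1 - Real.exp (-(lam n * t))) / (lam n * t) : ℝ) : ℂ)) ?_ ?_ y).congr' ?_
    · filter_upwards [self_mem_nhdsWithin] with t ht using hl.isBVNull_expDiv ht
    · intro k
      exact_mod_cast (Complex.continuous_ofReal.tendsto 1).comp (tendsto_expDiv (hl.pos k))
    · filter_upwards [self_mem_nhdsWithin] with t ht
      refine h.ext_projDiff fun k => ?_
      rw [h.projDiff_multiplier (hl.isBVNull_expDiv ht), hquot x k t ht, hxy k]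
  · intro hlim k
    refine tendsto_nhds_unique (((projDiff P k).continuous.tendsto y).comp hlim) ?_
    have h1 : Tendsto (fun t : ℝ => (((1 - Real.exp (-(lam k * t))) / (lam k * t) : ℝ) : ℂ) •
        (-(lam k : ℂ) • projDiff P k x)) (𝓝[>] 0)
        (𝓝 ((1 : ℂ) • (-(lam k : ℂ) • projDiff P k x))) := by
      refine Tendsto.smul_const ?_ _
      exact_mod_cast (Complex.continuous_ofReal.tendsto 1).comp (tendsto_expDiv (hl.pos k))
    rw [one_smul] at h1
    refine h1.congr' ?_
    filter_upwards [self_mem_nhdsWithin] with t ht using (hquot x k t ht).symm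

theorem generatesBoundedAnalyticSemigroup (h : IsProjectionFiltration P K)
    (hl : IsExponentSequence lam) :
    GeneratesBoundedAnalyticSemigroup (-diagOperator P lam) :=
  ⟨_, _, h.isBoundedAnalyticSemigroup_diagSemigroup hl, h.isGenerator_diagOperator hl⟩

end IsProjectionFiltration

end DiagonalSemigroup

/-! ### The scalar equation `u' + lam u = h` as a low-pass filter. -/

section Relaxation

/-- The convolution of `h` with the exponential kernel of rate `lam` on `[0, ∞)`, normalised so
that its total mass is `1`; it equals `lam * u`, where `u' + lam * u = h` and `u 0 = 0`. -/
noncomputable def relax (lam : ℝ) (h : ℝ → ℂ) (t : ℝ) : ℂ :=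
  lam * Complex.exp (-(lam * t)) * ∫ s in (0 : ℝ)..t, Complex.exp (lam * s) * h s

theorem intervalIntegrable_cexp_mul (lam : ℝ) {h : ℝ → ℂ} (hh : Continuous h) (a b : ℝ) :
    IntervalIntegrable (fun s : ℝ => Complex.exp (lam * s) * h s) volume a b :=
  Continuous.intervalIntegrable (by fun_prop) _ _

theorem relax_const_mul (lam : ℝ) (c : ℂ) (h : ℝ → ℂ) (t : ℝ) :
    relax lam (fun s => c * h s) t = c * relax lam h t := by
  simp only [relax, mul_left_comm _ c]
  rw [intervalIntegral.integral_const_mul]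
  ring

theorem relax_sub (lam : ℝ) {g h : ℝ → ℂ} (hg : Continuous g) (hh : Continuous h) (t : ℝ) :
    relax lam (fun s => g s - h s) t = relax lam g t - relax lam h t := by
  simp only [relax, mul_sub]
  rw [intervalIntegral.integral_sub (intervalIntegrable_cexp_mul lam hg 0 t)
    (intervalIntegrable_cexp_mul lam hh 0 t)]
  ring

theorem relax_sum (lam : ℝ) {h : ℕ → ℝ → ℂ} (hh : ∀ n, Continuous (h n)) (F : Finset ℕ) (t : ℝ) :
    relax lam (fun s => ∑ n ∈ F, h n s) t = ∑ n ∈ F, relax lam (h n) t := by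
  simp only [relax, Finset.mul_sum]
  rw [intervalIntegral.integral_finsetSum fun n _ => intervalIntegrable_cexp_mul lam (hh n) 0 t,
    Finset.mul_sum]

theorem hasDerivAt_cexp_ofReal_mul (lam s : ℝ) :
    HasDerivAt (fun s : ℝ => Complex.exp (lam * s)) (lam * Complex.exp (lam * s)) s := by
  have h1 : HasDerivAt (fun s : ℝ => (lam : ℂ) * (s : ℂ)) (lam * 1) s :=
    (Complex.ofRealCLM.hasDerivAt (x := s)).const_mul (lam : ℂ)
  convert! h1.cexp using 1
  ring

/-- On `[0, t]` the kernel has mass `1 - exp (-lam t) ≤ 1`. -/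
theorem norm_relax_le {lam : ℝ} (hlam : 0 < lam) {h : ℝ → ℂ} {M : ℝ}
    (hM : ∀ s, ‖h s‖ ≤ M) {t : ℝ} (ht : 0 ≤ t) : ‖relax lam h t‖ ≤ M := by
  have hM0 : 0 ≤ M := (norm_nonneg _).trans (hM 0)
  have hd : ∀ s : ℝ, HasDerivAt (fun s : ℝ => M / lam * Real.exp (lam * s))
      (Real.exp (lam * s) * M) s := by
    intro s
    have h1 : HasDerivAt (fun s : ℝ => lam * s) (lam * 1) s := (hasDerivAt_id s).const_mul lam
    convert! h1.exp.const_mul (M / lam) using 1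
    field_simp
  have h1 : ‖∫ s in (0 : ℝ)..t, Complex.exp (lam * s) * h s‖ ≤
      M / lam * Real.exp (lam * t) - M / lam := by
    have h2 := intervalIntegral.integral_eq_sub_of_hasDerivAt (a := 0) (b := t)
      (fun s _ => hd s) (Continuous.intervalIntegrable (by fun_prop) _ _)
    simp only [mul_zero, Real.exp_zero, mul_one] at h2
    rw [← h2]
    refine intervalIntegral.norm_integral_le_of_norm_le ht (Eventually.of_forall fun s _ => ?_)
      (Continuous.intervalIntegrable (by fun_prop) _ _)
    rw [norm_mul, Complex.norm_exp]
    simp only [Complex.mul_re, Complex.ofReal_re, Complex.ofReal_im, mul_zero, sub_zero]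
    exact mul_le_mul_of_nonneg_left (hM s) (Real.exp_pos _).le
  rw [relax, norm_mul, norm_mul, norm_cexp_neg_mul, Complex.norm_real, Real.norm_eq_abs,
    abs_of_pos hlam, Complex.ofReal_re]
  calc lam * Real.exp (-(lam * t)) * ‖∫ s in (0 : ℝ)..t, Complex.exp (lam * s) * h s‖
      ≤ lam * Real.exp (-(lam * t)) * (M / lam * Real.exp (lam * t) - M / lam) :=
        mul_le_mul_of_nonneg_left h1 (by positivity)
    _ = M - M * Real.exp (-(lam * t)) := by
        rw [Real.exp_neg]; field_simp
    _ ≤ M := sub_le_self _ (by positivity)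

/-- Integration by parts for `relax`. -/
theorem relax_deriv {lam : ℝ} {H : ℝ → ℂ} (hH : ContDiff ℝ 1 H) (t : ℝ) :
    relax lam (deriv H) t =
      lam * (H t - Complex.exp (-(lam * t)) * H 0 - relax lam H t) := by
  have hd : Differentiable ℝ H := hH.differentiable (by simp)
  have hc : Continuous (deriv H) := hH.continuous_deriv le_rfl
  have h1 := intervalIntegral.integral_mul_deriv_eq_deriv_mul (a := 0) (b := t)
    (u := fun s : ℝ => Complex.exp (lam * s)) (v := H)
    (fun s _ => hasDerivAt_cexp_ofReal_mul lam s) (fun s _ => (hd s).hasDerivAt)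
    (Continuous.intervalIntegrable (by fun_prop) _ _)
    (hc.intervalIntegrable _ _)
  have e : Complex.exp (-(lam * t)) * Complex.exp (lam * t) = 1 := by
    rw [← Complex.exp_add]; simp
  simp only [relax]
  rw [h1]
  simp only [Complex.ofReal_zero, mul_zero, Complex.exp_zero, one_mul, mul_assoc]
  rw [intervalIntegral.integral_const_mul]
  linear_combination (lam : ℂ) * H t * e

/-- Slow functions pass the filter: by parts, the error is `relax lam (deriv H) / lam`. -/
theorem norm_relax_sub_le {lam : ℝ} (hlam : 0 < lam) {H : ℝ → ℂ} (hH : ContDiff ℝ 1 H)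
    (h0 : H 0 = 0) {L : ℝ} (hL : ∀ s, ‖deriv H s‖ ≤ L) {t : ℝ} (ht : 0 ≤ t) :
    ‖relax lam H t - H t‖ ≤ L / lam := by
  have h1 := relax_deriv (lam := lam) hH t
  have h2 := norm_relax_le hlam hL ht
  rw [h1, h0, mul_zero, sub_zero, norm_mul, Complex.norm_real, Real.norm_eq_abs, abs_of_pos hlam,
    norm_sub_rev] at h2
  rwa [le_div_iff₀' hlam]

/-- Fast oscillations are killed: integrating the sine gains `1 / mu`. The three terms of
`relax_deriv` each cost `lam * G / mu`, and the derivative falling on `g` costs `L / mu`. -/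
theorem norm_relax_sin_mul_le {lam mu : ℝ} (hlam : 0 < lam) (hmu : 0 < mu) {g : ℝ → ℂ}
    (hg : ContDiff ℝ 1 g) {G L : ℝ} (hG : ∀ s, ‖g s‖ ≤ G) (hL : ∀ s, ‖deriv g s‖ ≤ L)
    {t : ℝ} (ht : 0 ≤ t) :
    ‖relax lam (fun s => (Real.sin (mu * s) : ℂ) * g s) t‖ ≤ (3 * lam * G + L) / mu := by
  have hmu0 : (mu : ℂ) ≠ 0 := by exact_mod_cast hmu.ne'
  have hcos : ContDiff ℝ 1 fun s : ℝ => ((-(Real.cos (mu * s) / mu) : ℝ) : ℂ) :=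
    Complex.ofRealCLM.contDiff.comp
      (f := fun s : ℝ => -(Real.cos (mu * s) / mu)) (by fun_prop)
  have hH : ContDiff ℝ 1 fun s : ℝ => ((-(Real.cos (mu * s) / mu) : ℝ) : ℂ) * g s := hcos.mul hg
  have hderiv : ∀ s, deriv (fun s : ℝ => ((-(Real.cos (mu * s) / mu) : ℝ) : ℂ) * g s) s =
      (Real.sin (mu * s) : ℂ) * g s + ((-(Real.cos (mu * s) / mu) : ℝ) : ℂ) * deriv g s := by
    intro s
    have h1 : HasDerivAt (fun s : ℝ => -(Real.cos (mu * s) / mu)) (Real.sin (mu * s)) s := by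
      have h2 : HasDerivAt (fun s : ℝ => mu * s) (mu * 1) s := (hasDerivAt_id s).const_mul mu
      convert! (h2.cos.div_const mu).neg using 1
      field_simp
    exact (h1.ofReal_comp.mul ((hg.differentiable (by simp)) s).hasDerivAt).deriv
  have hcg : Continuous (deriv g) := hg.continuous_deriv le_rfl
  have e1 : relax lam (fun s => (Real.sin (mu * s) : ℂ) * g s) t =
      relax lam (deriv fun s : ℝ => ((-(Real.cos (mu * s) / mu) : ℝ) : ℂ) * g s) t -
        relax lam (fun s => ((-(Real.cos (mu * s) / mu) : ℝ) : ℂ) * deriv g s) t := by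
    have hc : Continuous fun s => ((-(Real.cos (mu * s) / mu) : ℝ) : ℂ) * deriv g s :=
      hcos.continuous.mul hcg
    rw [← relax_sub lam (hH.continuous_deriv le_rfl) hc]
    congr 1
    funext s
    rw [hderiv s]
    ring
  have hcb : ∀ s, ‖((-(Real.cos (mu * s) / mu) : ℝ) : ℂ)‖ ≤ 1 / mu := by
    intro s
    rw [Complex.norm_real, norm_neg, norm_div, Real.norm_eq_abs, Real.norm_of_nonneg hmu.le]
    gcongr
    exact Real.abs_cos_le_one _
  have hb : ∀ {k : ℝ → ℂ} {N : ℝ}, (∀ s, ‖k s‖ ≤ N) → ∀ s,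
      ‖((-(Real.cos (mu * s) / mu) : ℝ) : ℂ) * k s‖ ≤ N / mu := by
    intro k N hk s
    rw [norm_mul]
    calc _ ≤ 1 / mu * N := mul_le_mul (hcb s) (hk s) (norm_nonneg _) (by positivity)
      _ = N / mu := by ring
  have hexp : ‖Complex.exp (-(lam * t))‖ ≤ 1 := by
    rw [norm_cexp_neg_mul, Complex.ofReal_re, Real.exp_le_one_iff]
    have := mul_nonneg hlam.le ht
    linarith
  rw [e1, relax_deriv hH]
  refine (norm_sub_le _ _).trans ?_
  have b1 := norm_relax_le hlam (hb hL) ht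
  have b2 := norm_relax_le hlam (hb hG) ht
  have b3 := hb hG t
  have b4 : ‖Complex.exp (-(lam * t)) * (((-(Real.cos (mu * 0) / mu) : ℝ) : ℂ) * g 0)‖ ≤
      G / mu := by
    rw [norm_mul]
    exact (mul_le_of_le_one_left (norm_nonneg _) hexp).trans (hb hG 0)
  rw [norm_mul, Complex.norm_real, Real.norm_of_nonneg hlam.le]
  have b5 := (norm_sub_le _ _).trans (add_le_add ((norm_sub_le _ _).trans (add_le_add b3 b4)) b2)
  have b6 := mul_le_mul_of_nonneg_left b5 hlam.le
  refine (add_le_add b6 b1).trans (le_of_eq ?_)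
  ring

theorem hasSum_relax {lam : ℝ} {h : ℕ → ℝ → ℂ} (hh : ∀ n, Continuous (h n)) {u : ℕ → ℝ}
    (hu : Summable u) (hb : ∀ n s, ‖h n s‖ ≤ u n) (t : ℝ) :
    HasSum (fun n => relax lam (h n) t) (relax lam (fun s => ∑' n, h n s) t) := by
  refine HasSum.mul_left _ ?_
  refine intervalIntegral.hasSum_integral_of_dominated_convergence
    (fun n s => Real.exp (lam * s) * u n) (fun n => ?_) (fun n => ?_) ?_ ?_ ?_
  · exact Continuous.aestronglyMeasurable (by have := hh n; fun_prop)
  · refine Eventually.of_forall fun s _ => ?_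
    rw [norm_mul, Complex.norm_exp]
    simp only [Complex.mul_re, Complex.ofReal_re, Complex.ofReal_im, mul_zero, sub_zero]
    exact mul_le_mul_of_nonneg_left (hb n s) (Real.exp_pos _).le
  · exact Eventually.of_forall fun s _ => hu.mul_left _
  · simp_rw [tsum_mul_left]
    exact Continuous.intervalIntegrable (by fun_prop) _ _
  · refine Eventually.of_forall fun s _ => HasSum.mul_left _ ?_
    exact (Summable.of_norm_bounded hu fun n => hb n s).hasSum

/-- A solution of the integrated scalar equation `u' + lam * u = F`, `u 0 = 0`, is given by
`relax`. -/
theorem ae_mul_eq_relax {lam T : ℝ} (hT : 0 < T) {φ F : ℝ → ℂ} (hF : Continuous F)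
    (hφ : IntegrableOn φ (Ico 0 T))
    (h : ∀ᵐ t ∂(volume.restrict (Ico (0 : ℝ) T)), φ t = ∫ s in (0 : ℝ)..t, (F s - lam * φ s)) :
    ∀ᵐ t ∂(volume.restrict (Ico (0 : ℝ) T)), lam * φ t = relax lam F t := by
  have hG : IntegrableOn (fun s => F s - lam * φ s) (Icc 0 T) := by
    have h1 : IntegrableOn φ (Icc 0 T) := by
      rwa [IntegrableOn, restrict_Ico_eq_restrict_Icc.symm]
    exact (hF.integrableOn_Icc).sub (h1.const_mul _)
  set ψ : ℝ → ℂ := fun t => ∫ s in (0 : ℝ)..t, (F s - lam * φ s) with hψ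
  have hψc : ContinuousOn ψ (Icc 0 T) := by
    rw [← uIcc_of_le hT.le] at hG ⊢
    exact intervalIntegral.continuousOn_primitive_interval hG
  -- `φ` is known only almost everywhere. `χ` is a continuous representative, extended by constants
  -- beyond `[0, T]`, so that `H` is differentiable on the whole line and an integrating factor
  -- applies.
  set χ : ℝ → ℂ := IccExtend hT.le ((Icc 0 T).domRestrict ψ) with hχ
  have hχc : Continuous χ := (continuousOn_iff_continuous_domRestrict.mp hψc).Icc_extend'
  have hχe : ∀ t ∈ Icc 0 T, χ t = ψ t := fun t ht => by
    rw [hχ, IccExtend_of_mem hT.le _ ht]; rfl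
  set H : ℝ → ℂ := fun t => ∫ s in (0 : ℝ)..t, (F s - lam * χ s) with hH
  have hφχ : ∀ᵐ t ∂(volume.restrict (Ico (0 : ℝ) T)), φ t = χ t := by
    filter_upwards [h, self_mem_ae_restrict measurableSet_Ico] with t ht htT
    rw [ht, hχe t ⟨htT.1, htT.2.le⟩]
  have hHχ : ∀ t ∈ Icc 0 T, H t = χ t := by
    intro t ht
    rw [hχe t ht]
    refine intervalIntegral.integral_congr_ae ?_
    rw [ae_restrict_iff' measurableSet_Ico] at hφχ
    -- The equality holds almost everywhere on `[0, T)`, while `(0, t]` may contain the null point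
    -- `T`.
    filter_upwards [hφχ, compl_mem_ae_iff.mpr (measure_singleton T)] with s hs hsT hs'
    rw [uIoc_of_le ht.1] at hs'
    rw [hs ⟨hs'.1.le, lt_of_le_of_ne (hs'.2.trans ht.2) hsT⟩]
  have hHd : ∀ t, HasDerivAt H (F t - lam * χ t) t := fun t =>
    intervalIntegral.integral_hasDerivAt_right
      (Continuous.intervalIntegrable (by fun_prop) _ _)
      (Continuous.stronglyMeasurableAtFilter (by fun_prop) _ _)
      (Continuous.continuousAt (by fun_prop))
  filter_upwards [hφχ, self_mem_ae_restrict measurableSet_Ico] with t ht htT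
  have hE := intervalIntegral.integral_eq_sub_of_hasDerivAt (a := 0) (b := t)
    (f := fun s => Complex.exp (lam * s) * H s)
    (fun s _ => (hasDerivAt_cexp_ofReal_mul lam s).mul (hHd s))
    (Continuous.intervalIntegrable (by
      have : Continuous H := continuous_iff_continuousAt.mpr fun s => (hHd s).continuousAt
      fun_prop) _ _)
  have hH0 : H 0 = 0 := by simp [hH]
  have e1 : ∫ s in (0 : ℝ)..t, (lam * Complex.exp (lam * s) * H s +
      Complex.exp (lam * s) * (F s - lam * χ s)) =
      ∫ s in (0 : ℝ)..t, Complex.exp (lam * s) * F s := by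
    refine intervalIntegral.integral_congr fun s hs => ?_
    rw [uIcc_of_le htT.1] at hs
    rw [hHχ s ⟨hs.1, hs.2.trans htT.2.le⟩]
    ring
  have e : Complex.exp (-(lam * t)) * Complex.exp (lam * t) = 1 := by
    rw [← Complex.exp_add]; simp
  rw [e1, hH0, mul_zero, sub_zero, hHχ t ⟨htT.1, htT.2.le⟩] at hE
  rw [ht, relax, hE]
  linear_combination -(lam : ℂ) * χ t * e

end Relaxation

/-! ### Riesz products and the action of the filter on them. -/

section RieszProducts

/-- The exponents of the counterexamples. -/
def rate (k : ℕ) : ℝ := 64 ^ (k ^ 2)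

/-- Frequencies interlacing with `rate`. -/
def freq (k : ℕ) : ℝ := 64 ^ (k ^ 2 + k)

theorem rate_pos (k : ℕ) : 0 < rate k := by unfold rate; positivity

theorem freq_pos (k : ℕ) : 0 < freq k := by unfold freq; positivity

/-- The gaps `freq k / rate k = 64 ^ k` and `rate (k + 1) / freq k = 64 ^ (k + 1)` beat the losses
of order `4 ^ k` in the bounds below, leaving `(1 / 16) ^ k`. -/
theorem freq_eq (k : ℕ) : freq k = rate k * 64 ^ k := pow_add _ _ _

theorem rate_succ (k : ℕ) : rate (k + 1) = freq k * 64 ^ (k + 1) := by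
  rw [rate, freq, ← pow_add]
  congr 1
  ring

theorem rate_le_freq (k : ℕ) : rate k ≤ freq k := by
  rw [freq_eq]
  exact le_mul_of_one_le_right (rate_pos k).le (one_le_pow₀ (by norm_num))

theorem freq_le_rate_succ (k : ℕ) : freq k ≤ rate (k + 1) := by
  rw [rate_succ]
  exact le_mul_of_one_le_right (freq_pos k).le (one_le_pow₀ (by norm_num))

theorem rate_monotone : Monotone rate :=
  monotone_nat_of_le_succ fun k => (rate_le_freq k).trans (freq_le_rate_succ k)

theorem freq_monotone : Monotone freq :=
  monotone_nat_of_le_succ fun k => (freq_le_rate_succ k).trans (rate_le_freq (k + 1))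

theorem isExponentSequence_rate : IsExponentSequence rate where
  mono := rate_monotone
  pos := rate_pos
  le n := by
    have h1 : n < 64 ^ n := Nat.lt_pow_self (by norm_num)
    have h2 : (64 : ℕ) ^ n ≤ 64 ^ (n ^ 2) :=
      Nat.pow_le_pow_right (by norm_num) (Nat.le_self_pow two_ne_zero n)
    unfold rate
    exact_mod_cast h1.le.trans h2

theorem natCast_le_freq (n : ℕ) : (n : ℝ) ≤ freq n :=
  (isExponentSequence_rate.le n).trans (rate_le_freq n)

/-- The Riesz product `∏ j < n, (1 + i b_j sin (freq j t))`. -/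
noncomputable def riesz (b : ℕ → ℝ) : ℕ → ℝ → ℂ
  | 0, _ => 1
  | n + 1, t => riesz b n t + Complex.I * b n * (Real.sin (freq n * t) * riesz b n t)

/-- The increment `riesz b (n + 1) - riesz b n`. -/
noncomputable def rieszIncr (b : ℕ → ℝ) (n : ℕ) (t : ℝ) : ℂ :=
  Complex.I * b n * (Real.sin (freq n * t) * riesz b n t)

theorem riesz_succ (b : ℕ → ℝ) (n : ℕ) (t : ℝ) :
    riesz b (n + 1) t = riesz b n t + rieszIncr b n t := rfl

theorem riesz_eq_sum (b : ℕ → ℝ) (n : ℕ) (t : ℝ) :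
    riesz b n t - 1 = ∑ j ∈ Finset.range n, rieszIncr b j t := by
  induction n with
  | zero => simp [riesz]
  | succ n ih => rw [Finset.sum_range_succ, ← ih, riesz_succ]; ring

/-- The factor `i` makes `1` and `b sin` orthogonal in `ℂ`, so moduli never decrease and their
growth is governed by squares of coefficients. -/
theorem norm_riesz_succ_sq (b : ℕ → ℝ) (n : ℕ) (t : ℝ) :
    ‖riesz b (n + 1) t‖ ^ 2 =
      ‖riesz b n t‖ ^ 2 * (1 + b n ^ 2 * Real.sin (freq n * t) ^ 2) := by
  have e : riesz b (n + 1) t =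
      riesz b n t * (1 + ((b n * Real.sin (freq n * t) : ℝ) : ℂ) * Complex.I) := by
    rw [riesz_succ, rieszIncr]; push_cast; ring
  rw [e, norm_mul, mul_pow]
  congr 1
  rw [← Complex.normSq_eq_norm_sq, ← Complex.ofReal_one, Complex.normSq_add_mul_I]
  ring

theorem norm_riesz_sq_le (b : ℕ → ℝ) (n : ℕ) (t : ℝ) :
    ‖riesz b n t‖ ^ 2 ≤ ∏ j ∈ Finset.range n, (1 + b j ^ 2) := by
  induction n with
  | zero => simp [riesz]
  | succ n ih =>
    rw [norm_riesz_succ_sq, Finset.prod_range_succ]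
    refine mul_le_mul ih ?_ (by positivity) (Finset.prod_nonneg fun _ _ => by positivity)
    nlinarith [Real.sin_sq_le_one (freq n * t), sq_nonneg (b n)]

theorem one_add_sum_le_norm_riesz_sq (b : ℕ → ℝ) (n : ℕ) (t : ℝ) :
    1 + ∑ j ∈ Finset.range n, b j ^ 2 * Real.sin (freq j * t) ^ 2 ≤ ‖riesz b n t‖ ^ 2 := by
  induction n with
  | zero => simp [riesz]
  | succ n ih =>
    rw [norm_riesz_succ_sq, Finset.sum_range_succ]
    have h0 : 0 ≤ ∑ j ∈ Finset.range n, b j ^ 2 * Real.sin (freq j * t) ^ 2 :=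
      Finset.sum_nonneg fun _ _ => by positivity
    have h1 : 0 ≤ b n ^ 2 * Real.sin (freq n * t) ^ 2 := by positivity
    nlinarith

theorem one_le_norm_riesz (b : ℕ → ℝ) (n : ℕ) (t : ℝ) : 1 ≤ ‖riesz b n t‖ := by
  have h := one_add_sum_le_norm_riesz_sq b n t
  have h0 : 0 ≤ ∑ j ∈ Finset.range n, b j ^ 2 * Real.sin (freq j * t) ^ 2 :=
    Finset.sum_nonneg fun _ _ => by positivity
  exact (one_le_sq_iff₀ (norm_nonneg _)).mp (by linarith)

theorem norm_rieszIncr {b : ℕ → ℝ} {n : ℕ} (hb : 0 ≤ b n) (t : ℝ) :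
    ‖rieszIncr b n t‖ = b n * (|Real.sin (freq n * t)| * ‖riesz b n t‖) := by
  rw [rieszIncr, norm_mul, norm_mul, norm_mul, Complex.norm_I, one_mul, Complex.norm_real,
    Complex.norm_real, Real.norm_of_nonneg hb, Real.norm_eq_abs]

theorem contDiff_riesz (b : ℕ → ℝ) (n : ℕ) : ContDiff ℝ 1 (riesz b n) := by
  induction n with
  | zero => exact contDiff_const (c := (1 : ℂ))
  | succ n ih =>
    have h1 : ContDiff ℝ 1 fun t : ℝ => ((Real.sin (freq n * t) : ℝ) : ℂ) :=
      Complex.ofRealCLM.contDiff.comp (f := fun t : ℝ => Real.sin (freq n * t)) (by fun_prop)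
    exact ih.add (contDiff_const.mul (h1.mul ih))

theorem contDiff_rieszIncr (b : ℕ → ℝ) (n : ℕ) : ContDiff ℝ 1 (rieszIncr b n) := by
  have h1 : ContDiff ℝ 1 fun t : ℝ => ((Real.sin (freq n * t) : ℝ) : ℂ) :=
    Complex.ofRealCLM.contDiff.comp (f := fun t : ℝ => Real.sin (freq n * t)) (by fun_prop)
  exact contDiff_const.mul (h1.mul (contDiff_riesz b n))

theorem continuous_riesz (b : ℕ → ℝ) (n : ℕ) : Continuous (riesz b n) :=
  (contDiff_riesz b n).continuous

theorem continuous_rieszIncr (b : ℕ → ℝ) (n : ℕ) : Continuous (rieszIncr b n) :=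
  (contDiff_rieszIncr b n).continuous

variable {b : ℕ → ℝ}

theorem norm_riesz_le_two_pow (hb : ∀ n, b n ∈ Icc (0 : ℝ) 1)
    (n : ℕ) (t : ℝ) : ‖riesz b n t‖ ≤ 2 ^ n := by
  induction n with
  | zero => simp [riesz]
  | succ n ih =>
    rw [riesz_succ, pow_succ]
    refine (norm_add_le _ _).trans ?_
    rw [norm_rieszIncr (hb n).1]
    have h1 : |Real.sin (freq n * t)| * ‖riesz b n t‖ ≤ ‖riesz b n t‖ :=
      mul_le_of_le_one_left (norm_nonneg _) (Real.abs_sin_le_one _)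
    have h2 : b n * (|Real.sin (freq n * t)| * ‖riesz b n t‖) ≤ ‖riesz b n t‖ :=
      (mul_le_of_le_one_left (by positivity) (hb n).2).trans h1
    linarith

theorem norm_deriv_rieszIncr_le_add (hb : ∀ n, b n ∈ Icc (0 : ℝ) 1) (n : ℕ) (t : ℝ) :
    ‖deriv (rieszIncr b n) t‖ ≤ freq n * 2 ^ n + ‖deriv (riesz b n) t‖ := by
  have hs : HasDerivAt (fun t : ℝ => Real.sin (freq n * t)) (Real.cos (freq n * t) * freq n) t := by
    have h2 : HasDerivAt (fun s : ℝ => freq n * s) (freq n * 1) t :=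
      (hasDerivAt_id t).const_mul (freq n)
    convert! h2.sin using 1
    ring
  have hr : HasDerivAt (riesz b n) (deriv (riesz b n) t) t :=
    ((contDiff_riesz b n).differentiable (by simp) t).hasDerivAt
  have hd : HasDerivAt (rieszIncr b n) (Complex.I * b n *
      (((Real.cos (freq n * t) * freq n : ℝ) : ℂ) * riesz b n t +
        (Real.sin (freq n * t) : ℂ) * deriv (riesz b n) t)) t :=
    (hs.ofReal_comp.mul hr).const_mul _
  rw [hd.deriv, norm_mul, norm_mul, Complex.norm_I, one_mul, Complex.norm_real,
    Real.norm_of_nonneg (hb n).1]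
  refine (mul_le_of_le_one_left (norm_nonneg _) (hb n).2).trans ((norm_add_le _ _).trans ?_)
  rw [norm_mul, norm_mul, Complex.norm_real, Complex.norm_real, norm_mul,
    Real.norm_of_nonneg (freq_pos n).le, Real.norm_eq_abs, Real.norm_eq_abs]
  refine add_le_add ?_ (mul_le_of_le_one_left (norm_nonneg _) (Real.abs_sin_le_one _))
  refine mul_le_mul ?_ (norm_riesz_le_two_pow hb n t) (norm_nonneg _) (freq_pos n).le
  exact mul_le_of_le_one_left (freq_pos n).le (Real.abs_cos_le_one _)

/-- Only frequencies `freq j` with `j < n` occur, and they lie below `rate n`. -/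
theorem norm_deriv_riesz_le (hb : ∀ n, b n ∈ Icc (0 : ℝ) 1)
    (n : ℕ) (t : ℝ) : ‖deriv (riesz b n) t‖ ≤ 4 ^ n * rate n := by
  induction n with
  | zero =>
    have : riesz b 0 = fun _ => (1 : ℂ) := rfl
    simp [this, (rate_pos 0).le]
  | succ n ih =>
    have hr : HasDerivAt (riesz b n) (deriv (riesz b n) t) t :=
      ((contDiff_riesz b n).differentiable (by simp) t).hasDerivAt
    have hi : HasDerivAt (rieszIncr b n) (deriv (rieszIncr b n) t) t :=
      ((contDiff_rieszIncr b n).differentiable (by simp) t).hasDerivAt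
    have hd : HasDerivAt (riesz b (n + 1)) (deriv (riesz b n) t + deriv (rieszIncr b n) t) t :=
      hr.add hi
    rw [hd.deriv]
    have h1 := norm_add_le (deriv (riesz b n) t) (deriv (rieszIncr b n) t)
    have h2 := norm_deriv_rieszIncr_le_add hb n t
    have h3 : (2 : ℝ) ^ n ≤ 4 ^ n := pow_le_pow_left₀ (by norm_num) (by norm_num) n
    have h4 : (4 : ℝ) ^ n * rate n ≤ 4 ^ n * rate (n + 1) :=
      mul_le_mul_of_nonneg_left (rate_monotone n.le_succ) (by positivity)
    have h5 : freq n * 2 ^ n ≤ rate (n + 1) * 4 ^ n :=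
      mul_le_mul (freq_le_rate_succ n) h3 (by positivity) (rate_pos _).le
    have h6 : 0 < (4 : ℝ) ^ n * rate (n + 1) := mul_pos (by positivity) (rate_pos _)
    rw [pow_succ]
    linarith

theorem norm_deriv_rieszIncr_le (hb : ∀ n, b n ∈ Icc (0 : ℝ) 1) (n : ℕ) (t : ℝ) :
    ‖deriv (rieszIncr b n) t‖ ≤ 2 * 4 ^ n * freq n := by
  have h2 := norm_deriv_rieszIncr_le_add hb n t
  have h3 : (2 : ℝ) ^ n ≤ 4 ^ n := pow_le_pow_left₀ (by norm_num) (by norm_num) n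
  have h4 : (4 : ℝ) ^ n * rate n ≤ 4 ^ n * freq n :=
    mul_le_mul_of_nonneg_left (rate_le_freq n) (by positivity)
  have h5 := mul_le_mul_of_nonneg_left h3 (freq_pos n).le
  linarith [norm_deriv_riesz_le hb n t]

/-- For `j < k` the increment is slow compared with `rate k`: its derivative is at most `2 * 4 ^ j *
freq j`, while `rate k = freq (k - 1) * 64 ^ k`. -/
theorem norm_relax_rieszIncr_sub_le (hb : ∀ n, b n ∈ Icc (0 : ℝ) 1)
    {j k : ℕ} (hjk : j < k) {t : ℝ} (ht : 0 ≤ t) :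
    ‖relax (rate k) (rieszIncr b j) t - rieszIncr b j t‖ ≤ 4 * (1 / 16) ^ k := by
  refine (norm_relax_sub_le (rate_pos k) (contDiff_rieszIncr b j) (by simp [rieszIncr])
    (norm_deriv_rieszIncr_le hb j) ht).trans ?_
  obtain ⟨k, rfl⟩ : ∃ i, k = i + 1 := ⟨k - 1, by omega⟩
  rw [rate_succ, div_le_iff₀ (mul_pos (freq_pos k) (by positivity))]
  have h1 : freq j ≤ freq k := freq_monotone (by omega)
  have h2 : (4 : ℝ) ^ j ≤ 4 ^ (k + 1) := pow_le_pow_right₀ (by norm_num) hjk.le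
  have h3 : ((1 : ℝ) / 16) ^ (k + 1) * 64 ^ (k + 1) = 4 ^ (k + 1) := by
    rw [← mul_pow]; norm_num
  calc 2 * 4 ^ j * freq j ≤ 2 * 4 ^ (k + 1) * freq k := by
        gcongr
        exact (freq_pos j).le
    _ ≤ 4 * 4 ^ (k + 1) * freq k := by
        have := freq_pos k
        gcongr
        norm_num
    _ = 4 * (1 / 16) ^ (k + 1) * (freq k * 64 ^ (k + 1)) := by rw [← h3]; ring

/-- For `j ≥ k` the factor `sin (freq j s)` is fast compared both with `rate k` and with the
variation of `riesz b j`, which is of order `4 ^ j * rate j`. -/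
theorem norm_relax_rieszIncr_le (hb : ∀ n, b n ∈ Icc (0 : ℝ) 1)
    {j k : ℕ} (hkj : k ≤ j) {t : ℝ} (ht : 0 ≤ t) :
    ‖relax (rate k) (rieszIncr b j) t‖ ≤ 4 * (1 / 16) ^ j := by
  have e : rieszIncr b j =
      fun s => Complex.I * b j * ((Real.sin (freq j * s) : ℂ) * riesz b j s) := rfl
  rw [e, relax_const_mul, norm_mul, norm_mul, Complex.norm_I, one_mul, Complex.norm_real,
    Real.norm_of_nonneg (hb j).1]
  refine (mul_le_of_le_one_left (norm_nonneg _) (hb j).2).trans ?_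
  refine (norm_relax_sin_mul_le (rate_pos k) (freq_pos j) (contDiff_riesz b j)
    (norm_riesz_le_two_pow hb j) (norm_deriv_riesz_le hb j) ht).trans ?_
  rw [div_le_iff₀ (freq_pos j), freq_eq]
  have h1 : rate k ≤ rate j := rate_monotone hkj
  have h3 : ((1 : ℝ) / 16) ^ j * 64 ^ j = 4 ^ j := by
    rw [← mul_pow]; norm_num
  have h4 : (2 : ℝ) ^ j ≤ 4 ^ j := pow_le_pow_left₀ (by norm_num) (by norm_num) j
  have h5 : 3 * rate k * 2 ^ j ≤ 3 * rate j * 4 ^ j := by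
    have := rate_pos k
    have := rate_pos j
    gcongr
  calc 3 * rate k * 2 ^ j + 4 ^ j * rate j ≤ 4 * 4 ^ j * rate j := by linarith
    _ = 4 * (1 / 16) ^ j * (rate j * 64 ^ j) := by rw [← h3]; ring

/-- Relaxation at rate `rate k` cuts the Riesz product down to its first `k` factors. -/
theorem norm_relax_riesz_sub_le (hb : ∀ n, b n ∈ Icc (0 : ℝ) 1)
    {k m : ℕ} (hkm : k ≤ m) {t : ℝ} (ht : 0 ≤ t) :
    ‖relax (rate k) (fun s => riesz b m s - 1) t - (riesz b k t - 1)‖ ≤ 12 * (1 / 4) ^ k := by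
  have e1 : (fun s => riesz b m s - 1) = fun s => ∑ j ∈ Finset.range m, rieszIncr b j s :=
    funext fun s => riesz_eq_sum b m s
  rw [e1, relax_sum _ (continuous_rieszIncr b), riesz_eq_sum,
    ← Finset.sum_range_add_sum_Ico _ hkm, add_sub_right_comm, ← Finset.sum_sub_distrib]
  have b1 : ‖∑ j ∈ Finset.range k, (relax (rate k) (rieszIncr b j) t - rieszIncr b j t)‖ ≤
      4 * (1 / 4) ^ k := by
    refine (norm_sum_le_of_le (f := fun j => relax (rate k) (rieszIncr b j) t - rieszIncr b j t) _
      fun j hj => norm_relax_rieszIncr_sub_le hb (Finset.mem_range.mp hj) ht).trans ?_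
    rw [Finset.sum_const, Finset.card_range, nsmul_eq_mul]
    have h1 : (k : ℝ) ≤ 4 ^ k := by exact_mod_cast (Nat.lt_pow_self (by norm_num : 1 < 4)).le
    have h2 : (4 : ℝ) ^ k * (1 / 16) ^ k = (1 / 4) ^ k := by rw [← mul_pow]; norm_num
    calc (k : ℝ) * (4 * (1 / 16) ^ k) ≤ 4 ^ k * (4 * (1 / 16) ^ k) := by gcongr
      _ = 4 * (1 / 4) ^ k := by rw [← h2]; ring
  have b2 : ‖∑ j ∈ Finset.Ico k m, relax (rate k) (rieszIncr b j) t‖ ≤ 8 * (1 / 4) ^ k := by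
    refine (norm_sum_le_of_le (f := fun j => relax (rate k) (rieszIncr b j) t) _
      fun j hj => norm_relax_rieszIncr_le hb (Finset.mem_Ico.mp hj).1 ht).trans ?_
    rw [Finset.sum_Ico_eq_sum_range]
    have h2 : ∀ i : ℕ, (4 : ℝ) * (1 / 16) ^ (k + i) ≤ 4 * (1 / 4) ^ k * (1 / 2) ^ i := by
      intro i
      rw [pow_add, mul_assoc]
      gcongr <;> norm_num
    refine (Finset.sum_le_sum fun i _ => h2 i).trans ?_
    rw [← Finset.mul_sum]
    have h3 : ∑ i ∈ Finset.range (m - k), ((1 : ℝ) / 2) ^ i ≤ 2 := by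
      refine (Summable.sum_le_tsum _ (fun _ _ => by positivity) summable_geometric_two).trans ?_
      rw [tsum_geometric_two]
    have h4 : (0 : ℝ) < (1 / 4) ^ k := by positivity
    nlinarith
  refine (norm_add_le _ _).trans ?_
  linarith

end RieszProducts

/-! ### A Cantor–Lebesgue type lemma for squared sines. -/

section CantorLebesgue

theorem le_integral_sin_sq {mu T : ℝ} (hmu : 0 < mu) :
    T / 2 - 1 / (2 * mu) ≤ ∫ t in (0 : ℝ)..T, Real.sin (mu * t) ^ 2 := by
  have hd : ∀ t : ℝ, HasDerivAt
      (fun t : ℝ => t / 2 - Real.sin (mu * t) * Real.cos (mu * t) / (2 * mu))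
      (Real.sin (mu * t) ^ 2) t := by
    intro t
    have h2 : HasDerivAt (fun s : ℝ => mu * s) (mu * 1) t := (hasDerivAt_id t).const_mul mu
    convert! ((hasDerivAt_id t).div_const 2).sub ((h2.sin.mul h2.cos).div_const (2 * mu)) using 1
    have h3 := Real.sin_sq_add_cos_sq (mu * t)
    field_simp
    linear_combination h3
  rw [intervalIntegral.integral_eq_sub_of_hasDerivAt (fun t _ => hd t)
    (Continuous.intervalIntegrable (by fun_prop) _ _)]
  have h1 : Real.sin (mu * T) * Real.cos (mu * T) ≤ 1 := by
    nlinarith [Real.sin_sq_add_cos_sq (mu * T), sq_nonneg (Real.sin (mu * T) - Real.cos (mu * T)),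
      sq_nonneg (Real.sin (mu * T)), sq_nonneg (Real.cos (mu * T))]
  have h2 : Real.sin (mu * T) * Real.cos (mu * T) / (2 * mu) ≤ 1 / (2 * mu) := by gcongr
  simp only [mul_zero, Real.sin_zero, zero_mul, zero_div, sub_zero]
  linarith

/-- If `∑ β k * sin (freq k * t) ^ 2` is bounded for almost every `t ∈ [0, T)`, then `∑ β k`
converges. -/
theorem summable_of_ae_bounded_sin_sq {β : ℕ → ℝ} (hβ : ∀ k, 0 ≤ β k) {T : ℝ} (hT : 0 < T)
    (h : ∀ᵐ t ∂(volume.restrict (Ico (0 : ℝ) T)), ∃ M : ℝ, ∀ N,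
      ∑ k ∈ Finset.range N, β k * Real.sin (freq k * t) ^ 2 ≤ M) : Summable β := by
  set Q : ℕ → ℝ → ℝ := fun N t => ∑ k ∈ Finset.range N, β k * Real.sin (freq k * t) ^ 2 with hQ
  have hQc : ∀ N, Continuous (Q N) := fun N => by fun_prop
  -- The sets `E M` exhaust almost all of `[0, T)`, so some `E M` misses at most `T / 8`. There `sin
  -- ^ 2` still has integral at least `T / 2 - T / 8 - T / 8 = T / 4` once `freq k ≥ 4 / T`;
  -- integrating the bound over `E M` then gives `∑ β k ≤ 4 * M` beyond `k₀`.
  set E : ℕ → Set ℝ := fun M => {t | ∀ N, Q N t ≤ M} with hE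
  have hEm : ∀ M, MeasurableSet (E M) := fun M => by
    have : E M = ⋂ N, {t | Q N t ≤ M} := by ext; simp [hE]
    rw [this]
    exact (isClosed_iInter fun N => isClosed_le (hQc N) continuous_const).measurableSet
  have hmono : Monotone E := fun M M' hMM t ht N => (ht N).trans (by exact_mod_cast hMM)
  have hfull : volume.restrict (Ico (0 : ℝ) T) (⋃ M, E M) = ENNReal.ofReal T := by
    have h1 : ∀ᵐ t ∂(volume.restrict (Ico (0 : ℝ) T)), t ∈ ⋃ M, E M := by
      filter_upwards [h] with t ⟨M, hM⟩
      exact mem_iUnion.mpr ⟨⌈M⌉₊, fun N => (hM N).trans (Nat.le_ceil M)⟩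
    rw [measure_eq_measure_of_null_sdiff (subset_univ _)]
    · simp
    · rw [← compl_eq_univ_sdiff]
      exact h1
  have hlim := tendsto_measure_iUnion_atTop (μ := volume.restrict (Ico (0 : ℝ) T)) hmono
  rw [hfull] at hlim
  obtain ⟨M, hM⟩ := (hlim.eventually (lt_mem_nhds
    ((ENNReal.ofReal_lt_ofReal_iff hT).mpr (by linarith : 7 * T / 8 < T)))).exists
  have hMr : 7 * T / 8 ≤ (volume.restrict (Ico (0 : ℝ) T)).real (E M) := by
    rw [Measure.real]
    exact (ENNReal.ofReal_le_iff_le_toReal (measure_ne_top _ _)).mp hM.le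
  have hcompl : (volume.restrict (Ico (0 : ℝ) T)).real (E M)ᶜ ≤ T / 8 := by
    rw [measureReal_compl (hEm M)]
    have : (volume.restrict (Ico (0 : ℝ) T)).real univ = T := by simp [Measure.real, hT.le]
    linarith
  have hint : ∀ g : ℝ → ℝ, Continuous g → Integrable g (volume.restrict (Ico (0 : ℝ) T)) :=
    fun g hg => (hg.integrableOn_Icc (a := 0) (b := T)).mono_set Ico_subset_Icc_self
  have hsin : ∀ k, T / 2 - 1 / (2 * freq k) - T / 8 ≤
      ∫ t in E M, Real.sin (freq k * t) ^ 2 ∂(volume.restrict (Ico (0 : ℝ) T)) := by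
    intro k
    have h1 := le_integral_sin_sq (T := T) (freq_pos k)
    rw [intervalIntegral.integral_of_le hT.le, ← integral_Ico_eq_integral_Ioc,
      ← integral_add_compl (hEm M) (hint _ (by fun_prop))] at h1
    have h2 : ∫ t in (E M)ᶜ, Real.sin (freq k * t) ^ 2 ∂(volume.restrict (Ico (0 : ℝ) T)) ≤
        T / 8 := by
      refine le_trans ?_ hcompl
      rw [← setIntegral_one_eq_measureReal]
      refine integral_mono (hint _ (by fun_prop)).integrableOn
        (hint _ continuous_const).integrableOn fun t => Real.sin_sq_le_one _
    linarith
  obtain ⟨k₀, hk₀⟩ := exists_nat_ge (4 / T)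
  have hk₀' : ∀ k, k₀ ≤ k →
      T / 4 ≤ ∫ t in E M, Real.sin (freq k * t) ^ 2 ∂(volume.restrict (Ico (0 : ℝ) T)) := by
    intro k hk
    refine le_trans ?_ (hsin k)
    have h1 : 4 / T ≤ freq k :=
      hk₀.trans ((Nat.cast_le.mpr hk).trans (natCast_le_freq k))
    have h2 : 1 / (2 * freq k) ≤ T / 8 := by
      rw [div_le_iff₀ hT] at h1
      rw [div_le_div_iff₀ (by linarith [freq_pos k]) (by norm_num)]
      linarith
    linarith
  rw [← summable_nat_add_iff k₀]
  refine summable_of_sum_range_le (c := 4 * M) (fun k => hβ _) fun N => ?_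
  have h1 : ∫ t in E M, Q (N + k₀) t ∂(volume.restrict (Ico (0 : ℝ) T)) ≤ M * T := by
    have h2 : ∫ t in E M, Q (N + k₀) t ∂(volume.restrict (Ico (0 : ℝ) T)) ≤
        ∫ t in E M, (M : ℝ) ∂(volume.restrict (Ico (0 : ℝ) T)) :=
      setIntegral_mono_on (hint _ (hQc _)).integrableOn (hint _ continuous_const).integrableOn
        (hEm M) fun t ht => ht _
    refine h2.trans ?_
    rw [setIntegral_const, smul_eq_mul, mul_comm]
    have : (volume.restrict (Ico (0 : ℝ) T)).real (E M) ≤ T := by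
      refine (measureReal_mono (subset_univ _)).trans (le_of_eq ?_)
      simp [Measure.real, hT.le]
    gcongr
  have h2 : ∑ k ∈ Finset.range N, β (k + k₀) * (T / 4) ≤
      ∫ t in E M, Q (N + k₀) t ∂(volume.restrict (Ico (0 : ℝ) T)) := by
    simp only [hQ]
    rw [integral_finsetSum _ fun k _ => (hint _ (by fun_prop)).integrableOn]
    simp_rw [integral_const_mul]
    rw [add_comm N, Finset.sum_range_add]
    refine le_trans ?_ (le_add_of_nonneg_left (Finset.sum_nonneg fun k _ =>
      mul_nonneg (hβ k) (integral_nonneg fun t => sq_nonneg _)))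
    refine Finset.sum_le_sum fun k _ => ?_
    rw [add_comm k]
    exact mul_le_mul_of_nonneg_left (hk₀' _ (Nat.le_add_right _ _)) (hβ _)
  rw [← Finset.sum_mul] at h2
  have h3 := h2.trans h1
  nlinarith

end CantorLebesgue

/-! ### Reduction of the failure of maximal regularity to coordinates. -/

section Failure

variable {X : Type*} [NormedAddCommGroup X] [NormedSpace ℂ X] [CompleteSpace X]

/-- Along an eigenfunctional of `B`, the image `B u` of a solution of the Cauchy problem with
right-hand side `f` is obtained from `f` by relaxation. -/
theorem ae_eigenfunctional_eq_relax {B : X →ₗ.[ℂ] X} {p : ℝ≥0∞} (hp : 1 ≤ p) {T : ℝ} (hT : 0 < T)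
    {u v w g : LpTime X p T} (hv : HasDerivZero u v) (hw : HasImage B u w) (hvw : v + w = g)
    {f : ℝ → X} (hf : Continuous f) (hgf : g =ᵐ[volume.restrict (Ico (0 : ℝ) T)] f)
    {a : X →L[ℂ] ℂ} {lam : ℝ} (ha : ∀ x y, (x, y) ∈ B.graph → a y = lam * a x) :
    ∀ᵐ t ∂(volume.restrict (Ico (0 : ℝ) T)), a (w t) = relax lam (fun s => a (f s)) t := by
  have hui : Integrable u (volume.restrict (Ico (0 : ℝ) T)) := (Lp.memLp u).integrable hp
  have hvi : IntegrableOn v (Ico (0 : ℝ) T) volume := (Lp.memLp v).integrable hp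
  have hva : ∀ᵐ t ∂(volume.restrict (Ico (0 : ℝ) T)), a (v t) = a (f t) - lam * a (u t) := by
    filter_upwards [Lp.coeFn_add v w, hgf, hw] with t h1 h2 h3
    rw [hvw, h2] at h1
    rw [h1, Pi.add_apply, map_add, ha _ _ h3]
    ring
  have hmain := ae_mul_eq_relax (lam := lam) (T := T) hT (φ := fun t => a (u t))
    (F := fun t => a (f t)) (a.continuous.comp hf) (a.integrable_comp hui) ?_
  · filter_upwards [hmain, hw] with t h1 h2
    rw [ha _ _ h2, h1]
  · rw [ae_restrict_iff' measurableSet_Ico] at hva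
    filter_upwards [hv, self_mem_ae_restrict measurableSet_Ico] with t ht htT
    rw [ht, ← a.intervalIntegral_comp_comm]
    · refine intervalIntegral.integral_congr_ae ?_
      filter_upwards [hva] with s hs hs'
      rw [uIoc_of_le htT.1] at hs'
      exact hs ⟨hs'.1.le, hs'.2.trans_lt htT.2⟩
    · rw [intervalIntegrable_iff_integrableOn_Ioc_of_le htT.1]
      exact hvi.mono_set fun s hs => ⟨hs.1.le, hs.2.trans_lt htT.2⟩

/-- To refute maximal regularity of `B` it is enough to find a bounded continuous right-hand side
for which the coordinates of `B u` cannot be those of an element of `X`, on a set of times of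
positive measure. -/
theorem not_hasMaximalRegularity_of_eigenfunctionals {B : X →ₗ.[ℂ] X} {lam : ℕ → ℝ}
    {a : ℕ → X →L[ℂ] ℂ} (ha : ∀ n x y, (x, y) ∈ B.graph → a n y = lam n * a n x)
    {f : ℝ → X} (hf : Continuous f) {M : ℝ} (hM : ∀ t, ‖f t‖ ≤ M)
    (hbad : ∀ T : ℝ, 0 < T → ¬ ∀ᵐ t ∂(volume.restrict (Ico (0 : ℝ) T)),
      ∃ y : X, ∀ n, a n y = relax (lam n) (fun s => a n (f s)) t) :
    ¬ HasMaximalRegularity B := by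
  rintro ⟨p, T, hp, -, hT, hsolve, -⟩
  -- A bounded right-hand side lies in every `L^p` on a finite interval, so one `f` refutes all `p`
  -- and `T`.
  have hmem : MemLp f p (volume.restrict (Ico (0 : ℝ) T)) :=
    MemLp.of_bound hf.aestronglyMeasurable M (Eventually.of_forall hM)
  obtain ⟨u, ⟨v, w, hv, hw, hvw⟩, -⟩ := hsolve hmem.toLp
  refine hbad T hT ?_
  have h1 : ∀ n, ∀ᵐ t ∂(volume.restrict (Ico (0 : ℝ) T)),
      a n (w t) = relax (lam n) (fun s => a n (f s)) t := fun n =>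
    ae_eigenfunctional_eq_relax hp.le hT hv hw hvw hf hmem.coeFn_toLp (ha n)
  filter_upwards [ae_all_iff.mpr h1] with t ht using ⟨w t, ht⟩

end Failure

/-! ### Diagonal operators with respect to a Schauder basis. -/

section Biorthogonal

variable {X : Type*} [NormedAddCommGroup X] [NormedSpace ℂ X]

/-- A Schauder basis `e` with coordinate functionals `a` and basis constant at most `K`. -/
structure IsBasisWithConstant (a : ℕ → X →L[ℂ] ℂ) (e : ℕ → X) (K : ℝ) : Prop where
  biorthogonal : ∀ j k, a j (e k) = if j = k then 1 else 0
  bound_nonneg : 0 ≤ K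
  norm_sum_le : ∀ N x, ‖∑ k ∈ Finset.range (N + 1), a k x • e k‖ ≤ K * ‖x‖
  tendsto : ∀ x, Tendsto (fun N => ∑ k ∈ Finset.range (N + 1), a k x • e k) atTop (𝓝 x)

/-- The partial sum projections of a basis. -/
noncomputable def partialSumProj (a : ℕ → X →L[ℂ] ℂ) (e : ℕ → X) (N : ℕ) : X →L[ℂ] X :=
  ∑ k ∈ Finset.range (N + 1), (a k).smulRight (e k)

theorem partialSumProj_apply (a : ℕ → X →L[ℂ] ℂ) (e : ℕ → X) (N : ℕ) (x : X) :
    partialSumProj a e N x = ∑ k ∈ Finset.range (N + 1), a k x • e k := by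
  simp [partialSumProj]

theorem projDiff_partialSumProj (a : ℕ → X →L[ℂ] ℂ) (e : ℕ → X) (k : ℕ) (x : X) :
    projDiff (partialSumProj a e) k x = a k x • e k := by
  cases k with
  | zero => simp [projDiff, partialSumProj_apply]
  | succ k =>
    change partialSumProj a e (k + 1) x - partialSumProj a e k x = _
    rw [partialSumProj_apply, partialSumProj_apply, Finset.sum_range_succ, add_sub_cancel_left]

namespace IsBasisWithConstant

variable {a : ℕ → X →L[ℂ] ℂ} {e : ℕ → X} {K : ℝ}

theorem isProjectionFiltration (h : IsBasisWithConstant a e K) :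
    IsProjectionFiltration (partialSumProj a e) K where
  comp m n x := by
    have h1 : ∀ k, a k (partialSumProj a e n x) = if k < n + 1 then a k x else 0 := by
      intro k
      simp [partialSumProj_apply, h.biorthogonal, Finset.sum_ite_eq]
    rw [partialSumProj_apply a e m, partialSumProj_apply a e (min m n)]
    simp_rw [h1, ite_smul, zero_smul]
    rw [← Finset.sum_filter]
    refine Finset.sum_congr ?_ fun _ _ => rfl
    ext k
    simp only [Finset.mem_filter, Finset.mem_range]
    omega
  norm_le N := ContinuousLinearMap.opNorm_le_bound _ h.bound_nonneg fun x => by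
    rw [partialSumProj_apply]
    exact h.norm_sum_le N x
  tendsto x := by
    simp_rw [partialSumProj_apply]
    exact h.tendsto x

theorem apply_of_mem_graph (h : IsBasisWithConstant a e K) {lam : ℕ → ℝ} (k : ℕ) (x y : X)
    (hxy : (x, y) ∈ (diagOperator (partialSumProj a e) lam).graph) :
    a k y = lam k * a k x := by
  have h1 := h.isProjectionFiltration.mem_graph_diagOperator.mp hxy k
  simp only [projDiff_partialSumProj] at h1
  simpa [h.biorthogonal] using congrArg (a k) h1

/-- A space with a basis fails the maximal regularity property as soon as, for a suitable bounded
continuous right-hand side, the relaxed coordinates are not those of an element of the space. -/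
theorem not_maximalRegularityProperty [CompleteSpace X] (h : IsBasisWithConstant a e K)
    {lam : ℕ → ℝ} (hlam : IsExponentSequence lam) {f : ℝ → X} (hf : Continuous f) {M : ℝ}
    (hM : ∀ t, ‖f t‖ ≤ M)
    (hbad : ∀ T : ℝ, 0 < T → ¬ ∀ᵐ t ∂(volume.restrict (Ico (0 : ℝ) T)),
      ∃ y : X, ∀ n, a n y = relax (lam n) (fun s => a n (f s)) t) :
    ¬ MaximalRegularityProperty X := fun hX =>
  not_hasMaximalRegularity_of_eigenfunctionals h.apply_of_mem_graph hf hM hbad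
    (hX _ (h.isProjectionFiltration.generatesBoundedAnalyticSemigroup hlam))

end IsBasisWithConstant

end Biorthogonal

/-! ### The space `c₀` with its summing basis. -/

section Null

/-- A null sequence as an element of `c₀`. -/
def nullSeq (x : ℕ → ℂ) (hx : Tendsto x atTop (𝓝 0)) : C₀(ℕ, ℂ) where
  toFun := x
  continuous_toFun := continuous_of_discreteTopology
  zero_at_infty' := by rwa [cocompact_eq_cofinite, Nat.cofinite_eq_atTop]

theorem nullSeq_apply (x : ℕ → ℂ) (hx : Tendsto x atTop (𝓝 0)) (n : ℕ) : nullSeq x hx n = x n := rfl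

theorem tendsto_c0 (x : C₀(ℕ, ℂ)) : Tendsto x atTop (𝓝 0) := by
  have := x.zero_at_infty'
  rwa [cocompact_eq_cofinite, Nat.cofinite_eq_atTop] at this

theorem norm_c0_apply_le (x : C₀(ℕ, ℂ)) (n : ℕ) : ‖x n‖ ≤ ‖x‖ :=
  x.toBCF.norm_coe_le_norm n

theorem norm_c0_le {x : C₀(ℕ, ℂ)} {C : ℝ} (hC : 0 ≤ C) (h : ∀ n, ‖x n‖ ≤ C) : ‖x‖ ≤ C :=
  (BoundedContinuousFunction.norm_le (f := x.toBCF) hC).mpr h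

/-- The common null majorant `d` makes the tails uniformly small, leaving finitely many coordinates
to control. -/
theorem continuous_nullSeq {x : ℝ → ℕ → ℂ} (hx : ∀ t, Tendsto (x t) atTop (𝓝 0))
    (hc : ∀ n, Continuous fun t => x t n) {d : ℕ → ℝ} (hd : Tendsto d atTop (𝓝 0))
    (hxd : ∀ t n, ‖x t n‖ ≤ d n) : Continuous fun t => nullSeq (x t) (hx t) := by
  rw [continuous_iff_continuousAt]
  intro t
  rw [ContinuousAt, Metric.tendsto_nhds]
  intro ε hε
  obtain ⟨N, hN⟩ := (hd.eventually (gt_mem_nhds (by linarith : 0 < ε / 4))).exists_forall_of_atTop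
  have h1 : ∀ᶠ s in 𝓝 t, ∀ n ∈ Finset.range N, ‖x s n - x t n‖ < ε / 2 := by
    rw [Filter.eventually_all_finset]
    intro n _
    have := Metric.tendsto_nhds.mp ((hc n).tendsto t) (ε / 2) (half_pos hε)
    simpa only [dist_eq_norm] using this
  filter_upwards [h1] with s hs
  rw [dist_eq_norm]
  refine (norm_c0_le (half_pos hε).le fun n => ?_).trans_lt (half_lt_self hε)
  change ‖x s n - x t n‖ ≤ ε / 2
  by_cases hn : n < N
  · exact (hs n (Finset.mem_range.mpr hn)).le
  · have := hN n (not_lt.mp hn)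
    linarith [norm_sub_le (x s n) (x t n), hxd s n, hxd t n]

/-- The evaluation functionals on `c₀`. -/
noncomputable def c0Eval (n : ℕ) : C₀(ℕ, ℂ) →L[ℂ] ℂ :=
  LinearMap.mkContinuous
    { toFun := fun x => x n
      map_add' := fun _ _ => rfl
      map_smul' := fun _ _ => rfl } 1 fun x => by
    rw [one_mul]
    exact norm_c0_apply_le x n

theorem c0Eval_apply (n : ℕ) (x : C₀(ℕ, ℂ)) : c0Eval n x = x n := rfl

/-- The coordinate functionals of the summing basis of `c₀`. -/
noncomputable def summingFunctional (n : ℕ) : C₀(ℕ, ℂ) →L[ℂ] ℂ := c0Eval n - c0Eval (n + 1)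

theorem summingFunctional_apply (n : ℕ) (x : C₀(ℕ, ℂ)) :
    summingFunctional n x = x n - x (n + 1) := rfl

/-- The summing basis of `c₀`. -/
def summingBasis (k : ℕ) : C₀(ℕ, ℂ) :=
  nullSeq (fun i => if i ≤ k then 1 else 0) <| tendsto_const_nhds.congr' <| by
    filter_upwards [eventually_gt_atTop k] with i hi
    rw [if_neg hi.not_ge]

theorem summingBasis_apply (k i : ℕ) : summingBasis k i = if i ≤ k then 1 else 0 := rfl

theorem sum_summing_apply (N : ℕ) (x : C₀(ℕ, ℂ)) (i : ℕ) :
    (∑ k ∈ Finset.range (N + 1), summingFunctional k x • summingBasis k) i =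
      if i ≤ N then x i - x (N + 1) else 0 := by
  rw [← c0Eval_apply, map_sum]
  simp only [map_smul, c0Eval_apply, summingFunctional_apply, summingBasis_apply, smul_eq_mul,
    mul_ite, mul_one, mul_zero]
  induction N with
  | zero =>
    rcases Nat.eq_zero_or_pos i with rfl | hi
    · simp
    · simp [hi.ne']
  | succ N ih =>
    rw [Finset.sum_range_succ, ih]
    rcases lt_trichotomy i (N + 1) with hi | rfl | hi
    · rw [if_pos (by omega), if_pos (by omega), if_pos (by omega)]
      ring
    · simp
    · rw [if_neg (by omega), if_neg (by omega), if_neg (by omega), zero_add]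

theorem isBasisWithConstant_summing :
    IsBasisWithConstant summingFunctional summingBasis 2 where
  biorthogonal j k := by
    rw [summingFunctional_apply, summingBasis_apply, summingBasis_apply]
    rcases lt_trichotomy j k with h | rfl | h
    · rw [if_pos h.le, if_pos (by omega), if_neg h.ne, sub_self]
    · simp
    · rw [if_neg (by omega), if_neg (by omega), if_neg h.ne', sub_self]
  bound_nonneg := zero_le_two
  norm_sum_le N x := by
    refine norm_c0_le (by positivity) fun i => ?_
    rw [sum_summing_apply]
    split_ifs
    · linarith [norm_sub_le (x i) (x (N + 1)), norm_c0_apply_le x i, norm_c0_apply_le x (N + 1)]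
    · simp
  tendsto x := by
    rw [Metric.tendsto_nhds]
    intro ε hε
    obtain ⟨N₀, hN₀⟩ := (Metric.tendsto_nhds.mp (tendsto_c0 x) (ε / 2)
      (half_pos hε)).exists_forall_of_atTop
    simp only [dist_zero_right] at hN₀
    filter_upwards [eventually_ge_atTop N₀] with N hN
    rw [dist_eq_norm]
    refine (norm_c0_le (half_pos hε).le fun i => ?_).trans_lt (half_lt_self hε)
    rw [ZeroAtInftyContinuousMap.sub_apply, sum_summing_apply]
    split_ifs with hi
    · rw [sub_sub_cancel_left, norm_neg]
      exact (hN₀ _ (by omega)).le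
    · rw [zero_sub, norm_neg]
      exact (hN₀ _ (by omega)).le

/-- The coefficients of the Riesz products for `c₀`; their squares have infinite sum. -/
noncomputable def c0Coeff (j : ℕ) : ℝ := 1 / (2 * √(j + 1))

theorem c0Coeff_mem (j : ℕ) : c0Coeff j ∈ Icc (0 : ℝ) 1 := by
  refine ⟨by unfold c0Coeff; positivity, ?_⟩
  have h : (1 : ℝ) ≤ √(j + 1) := by
    rw [Real.one_le_sqrt]
    linarith [(Nat.cast_nonneg j : (0 : ℝ) ≤ j)]
  rw [c0Coeff, div_le_one (by positivity)]
  linarith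

theorem c0Coeff_sq (j : ℕ) : c0Coeff j ^ 2 = 1 / (4 * ((j : ℝ) + 1)) := by
  rw [c0Coeff, div_pow, mul_pow, Real.sq_sqrt (by positivity)]
  norm_num

/-- The factor `1 / 2` in `c0Coeff` serves here: `(1 + 1 / (4 (n + 1))) ^ 2 ≤ (n + 2) / (n + 1)`.
Then `c0Coeff n ^ 2` times the product still tends to zero, although `∑ c0Coeff n ^ 2` diverges. -/
theorem prod_c0Coeff_le (n : ℕ) :
    ∏ j ∈ Finset.range n, (1 + c0Coeff j ^ 2) ≤ √((n : ℝ) + 1) := by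
  induction n with
  | zero => simp
  | succ n ih =>
    rw [Finset.prod_range_succ]
    refine (mul_le_mul_of_nonneg_right ih (by positivity)).trans ?_
    refine Real.le_sqrt_of_sq_le ?_
    rw [mul_pow, Real.sq_sqrt (by positivity), c0Coeff_sq]
    have hn : (0 : ℝ) < (n : ℝ) + 1 := by positivity
    push_cast
    have : ((n : ℝ) + 1) * (1 + 1 / (4 * ((n : ℝ) + 1))) ^ 2 =
        (n : ℝ) + 1 + 1 / 2 + 1 / (16 * ((n : ℝ) + 1)) := by
      field_simp
      ring
    rw [this]
    have h2 : 1 / (16 * ((n : ℝ) + 1)) ≤ 1 / 2 := by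
      rw [div_le_div_iff₀ (by positivity) (by norm_num)]
      linarith [(Nat.cast_nonneg n : (0 : ℝ) ≤ n)]
    linarith

/-- The decay of the increments of the Riesz products for `c₀`. -/
noncomputable def c0Decay (n : ℕ) : ℝ := √(1 / (4 * √((n : ℝ) + 1)))

theorem tendsto_c0Decay : Tendsto c0Decay atTop (𝓝 0) := by
  have h1 : Tendsto (fun n : ℕ => (n : ℝ) + 1) atTop atTop :=
    tendsto_natCast_atTop_atTop.atTop_add tendsto_const_nhds
  have h2 : Tendsto (fun n : ℕ => 4 * √((n : ℝ) + 1)) atTop atTop :=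
    (Real.tendsto_sqrt_atTop.comp h1).const_mul_atTop (by norm_num)
  have h3 : Tendsto (fun n : ℕ => 1 / (4 * √((n : ℝ) + 1))) atTop (𝓝 0) :=
    tendsto_const_nhds.div_atTop h2
  have h4 := (Real.continuous_sqrt.tendsto 0).comp h3
  rwa [Real.sqrt_zero] at h4

theorem norm_rieszIncr_c0Coeff_le (n : ℕ) (t : ℝ) : ‖rieszIncr c0Coeff n t‖ ≤ c0Decay n := by
  refine Real.le_sqrt_of_sq_le ?_
  rw [norm_rieszIncr (c0Coeff_mem n).1, mul_pow, mul_pow, sq_abs, c0Coeff_sq]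
  have h1 := (norm_riesz_sq_le c0Coeff n t).trans (prod_c0Coeff_le n)
  have h2 : Real.sin (freq n * t) ^ 2 * ‖riesz c0Coeff n t‖ ^ 2 ≤ √((n : ℝ) + 1) :=
    (mul_le_of_le_one_left (by positivity) (Real.sin_sq_le_one _)).trans h1
  refine (mul_le_mul_of_nonneg_left h2 (by positivity)).trans (le_of_eq ?_)
  have h3 : √((n : ℝ) + 1) ^ 2 = (n : ℝ) + 1 := Real.sq_sqrt (by positivity)
  have h4 : 0 < √((n : ℝ) + 1) := by positivity
  rw [← h3, Real.sqrt_sq h4.le]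
  field_simp

/-- The coordinates of the right-hand side for `c₀`. -/
noncomputable def c0Seq (t : ℝ) : ℕ → ℂ
  | 0 => 0
  | n + 1 => rieszIncr c0Coeff n t

/-- Truncated subtraction makes the bound at `n = 0` equal to `c0Decay 0`, harmless since that entry
vanishes. -/
theorem norm_c0Seq_le (t : ℝ) (n : ℕ) : ‖c0Seq t n‖ ≤ c0Decay (n - 1) := by
  cases n with
  | zero => simp [c0Seq, c0Decay]
  | succ n => simpa [c0Seq] using norm_rieszIncr_c0Coeff_le n t

theorem tendsto_c0Decay_pred : Tendsto (fun n : ℕ => c0Decay (n - 1)) atTop (𝓝 0) :=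
  tendsto_c0Decay.comp (tendsto_sub_atTop_nat 1)

theorem tendsto_c0Seq (t : ℝ) : Tendsto (c0Seq t) atTop (𝓝 0) :=
  squeeze_zero_norm (norm_c0Seq_le t) tendsto_c0Decay_pred

theorem not_maximalRegularityProperty_c0 : ¬ MaximalRegularityProperty C₀(ℕ, ℂ) := by
  obtain ⟨M, hM⟩ := tendsto_c0Decay.bddAbove_range
  have hM' : ∀ n, c0Decay n ≤ M := fun n => hM (mem_range_self n)
  have hM0 : 0 ≤ M := (Real.sqrt_nonneg _).trans (hM' 0)
  refine isBasisWithConstant_summing.not_maximalRegularityProperty isExponentSequence_rate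
    (f := fun t => nullSeq (c0Seq t) (tendsto_c0Seq t)) (M := M)
    (continuous_nullSeq tendsto_c0Seq ?_ tendsto_c0Decay_pred norm_c0Seq_le) ?_ ?_
  · intro n
    cases n with
    | zero => exact continuous_const
    | succ n => exact continuous_rieszIncr c0Coeff n
  · exact fun t => norm_c0_le hM0 fun n => (norm_c0Seq_le t n).trans (hM' _)
  intro T hT hae
  have hsum : Summable fun j => c0Coeff j ^ 2 := by
    refine summable_of_ae_bounded_sin_sq (fun j => sq_nonneg _) hT ?_
    filter_upwards [hae, self_mem_ae_restrict measurableSet_Ico] with t ⟨y, hy⟩ htT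
    -- `21 = 1 + 4 + 16`: the constant term of the Riesz product, the coordinate `0`, and the summed
    -- filtering errors.
    refine ⟨(2 * ‖y‖ + 21) ^ 2, fun N => ?_⟩
    have h0 : ‖summingFunctional 0 y‖ ≤ 4 := by
      rw [hy 0]
      have e : (fun s => summingFunctional 0 (nullSeq (c0Seq s) (tendsto_c0Seq s))) =
          fun s => (-1 : ℂ) * rieszIncr c0Coeff 0 s := by
        funext s
        simp [summingFunctional_apply, nullSeq_apply, c0Seq]
      rw [e, relax_const_mul, norm_mul, norm_neg, norm_one, one_mul]
      simpa using norm_relax_rieszIncr_le c0Coeff_mem (le_refl 0) htT.1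
    -- The filter at `rate (n + 1)` keeps increment `n` and kills increment `n + 1`; each error is
    -- at most `4 * (1 / 16) ^ (n + 1)`.
    have h1 : ∀ n, ‖summingFunctional (n + 1) y - rieszIncr c0Coeff n t‖ ≤ 8 * (1 / 2) ^ n := by
      intro n
      rw [hy (n + 1)]
      have e : (fun s => summingFunctional (n + 1) (nullSeq (c0Seq s) (tendsto_c0Seq s))) =
          fun s => rieszIncr c0Coeff n s - rieszIncr c0Coeff (n + 1) s := by
        funext s
        simp [summingFunctional_apply, nullSeq_apply, c0Seq]
      rw [e, relax_sub _ (continuous_rieszIncr _ _) (continuous_rieszIncr _ _), sub_right_comm]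
      refine (norm_sub_le _ _).trans ((add_le_add
        (norm_relax_rieszIncr_sub_le c0Coeff_mem n.lt_succ_self htT.1)
        (norm_relax_rieszIncr_le c0Coeff_mem le_rfl htT.1)).trans ?_)
      have h2 : ((1 : ℝ) / 16) ^ (n + 1) ≤ (1 / 2) ^ n := by
        refine (pow_le_pow_of_le_one (by norm_num) (by norm_num) n.le_succ).trans ?_
        exact pow_le_pow_left₀ (by norm_num) (by norm_num) n
      rw [Nat.succ_eq_add_one]
      linarith
    have h2 : y 0 - y (N + 1) = summingFunctional 0 y +
        ∑ n ∈ Finset.range N, summingFunctional (n + 1) y := by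
      rw [add_comm (summingFunctional 0 y), ← Finset.sum_range_succ' fun n => summingFunctional n y]
      simp only [summingFunctional_apply]
      rw [Finset.sum_range_sub']
    have h3 : riesz c0Coeff N t = 1 + (y 0 - y (N + 1)) - summingFunctional 0 y -
        ∑ n ∈ Finset.range N, (summingFunctional (n + 1) y - rieszIncr c0Coeff n t) := by
      rw [h2, Finset.sum_sub_distrib, ← riesz_eq_sum]
      ring
    have h4 : ‖∑ n ∈ Finset.range N, (summingFunctional (n + 1) y - rieszIncr c0Coeff n t)‖ ≤
        16 := by
      refine (norm_sum_le_of_le _ fun n _ => h1 n).trans ?_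
      rw [← Finset.mul_sum]
      have := Summable.sum_le_tsum (Finset.range N) (fun _ _ => by positivity)
        summable_geometric_two
      rw [tsum_geometric_two] at this
      linarith
    have h5 : ‖riesz c0Coeff N t‖ ≤ 2 * ‖y‖ + 21 := by
      rw [h3]
      have i1 := norm_sub_le (1 + (y 0 - y (N + 1)) - summingFunctional 0 y)
        (∑ n ∈ Finset.range N, (summingFunctional (n + 1) y - rieszIncr c0Coeff n t))
      have i2 := norm_sub_le (1 + (y 0 - y (N + 1))) (summingFunctional 0 y)
      have i3 := norm_add_le (1 : ℂ) (y 0 - y (N + 1))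
      have i4 := norm_sub_le (y 0) (y (N + 1))
      rw [norm_one] at i3
      linarith [norm_c0_apply_le y 0, norm_c0_apply_le y (N + 1)]
    have h6 := one_add_sum_le_norm_riesz_sq c0Coeff N t
    have h7 := pow_le_pow_left₀ (norm_nonneg _) h5 2
    linarith
  have h1 := hsum.mul_left 4
  have h3 : Summable fun n : ℕ => (((n + 1 : ℕ) : ℝ))⁻¹ := by
    refine h1.congr fun n => ?_
    rw [c0Coeff_sq]
    push_cast
    field_simp
  exact Real.not_summable_natCast_inv ((summable_nat_add_iff 1).mp h3)

end Null

/-! ### The space `ℓ¹` with its difference basis. -/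

section Summing

/-- The tail sum functionals `x ↦ ∑ j ≥ n, x j` on `ℓ¹`. -/
noncomputable def tailSum (n : ℕ) : lp (fun _ : ℕ => ℂ) 1 →L[ℂ] ℂ :=
  lp.tsumCLM (α := ℕ) (𝕜 := ℂ) (E := ℂ) - ∑ j ∈ Finset.range n, lp.evalCLM ℂ (fun _ : ℕ => ℂ) 1 j

theorem tailSum_apply (n : ℕ) (x : lp (fun _ : ℕ => ℂ) 1) :
    tailSum n x = (∑' j, x j) - ∑ j ∈ Finset.range n, x j := by
  simp [tailSum, lp.tsumCLM_apply, lp.evalCLM]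

theorem tailSum_sub_succ (n : ℕ) (x : lp (fun _ : ℕ => ℂ) 1) :
    tailSum n x - tailSum (n + 1) x = x n := by
  rw [tailSum_apply, tailSum_apply, Finset.sum_range_succ]
  ring

theorem summable_norm_l1 (x : lp (fun _ : ℕ => ℂ) 1) : Summable fun j => ‖x j‖ := by
  simpa using (lp.memℓp x).summable (by simp)

theorem sum_norm_le_l1 (x : lp (fun _ : ℕ => ℂ) 1) (F : Finset ℕ) : ∑ j ∈ F, ‖x j‖ ≤ ‖x‖ := by
  simpa using lp.sum_rpow_le_norm_rpow (p := 1) (by simp) x F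

theorem tendsto_tailSum (x : lp (fun _ : ℕ => ℂ) 1) :
    Tendsto (fun n => tailSum n x) atTop (𝓝 0) := by
  simp_rw [tailSum_apply]
  have h := (Summable.of_norm (summable_norm_l1 x)).hasSum.tendsto_sum_nat
  simpa using (tendsto_const_nhds (x := ∑' j, x j)).sub h

theorem tailSum_single (n k : ℕ) (c : ℂ) :
    tailSum n (lp.single 1 k c) = if n ≤ k then c else 0 := by
  rw [tailSum_apply]
  simp only [lp.coeFn_single, tsum_pi_single, Finset.sum_pi_single', Finset.mem_range]
  by_cases h : n ≤ k
  · rw [if_pos h, if_neg (not_lt.mpr h), sub_zero]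
  · rw [if_neg h, if_pos (not_le.mp h), sub_self]

theorem norm_tailSum_le (n : ℕ) (x : lp (fun _ : ℕ => ℂ) 1) : ‖tailSum n x‖ ≤ 2 * ‖x‖ := by
  rw [tailSum_apply]
  have h1 := lp.norm_tsum_le x
  have h2 := (norm_sum_le (Finset.range n) fun j => x j).trans (sum_norm_le_l1 x _)
  linarith [norm_sub_le (∑' j, x j) (∑ j ∈ Finset.range n, x j)]

/-- The conditional basis `e₀, e₁ - e₀, e₂ - e₁, …` of `ℓ¹`. -/
noncomputable def differenceBasis : ℕ → lp (fun _ : ℕ => ℂ) 1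
  | 0 => lp.single 1 0 1
  | k + 1 => lp.single 1 (k + 1) 1 - lp.single 1 k 1

theorem smul_single_one (k : ℕ) (c : ℂ) :
    c • (lp.single 1 k (1 : ℂ) : lp (fun _ : ℕ => ℂ) 1) = lp.single 1 k c := by
  rw [← lp.single_smul, smul_eq_mul, mul_one]

/-- Summation by parts: the partial sum is the truncation of `x` with its remaining tail placed at
position `N`. Hence the basis constant `3 = 1 + 2`. -/
theorem sum_difference (N : ℕ) (x : lp (fun _ : ℕ => ℂ) 1) :
    ∑ k ∈ Finset.range (N + 1), tailSum k x • differenceBasis k =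
      ∑ k ∈ Finset.range N, lp.single 1 k (x k) + lp.single 1 N (tailSum N x) := by
  induction N with
  | zero => simp [differenceBasis, smul_single_one]
  | succ N ih =>
    rw [Finset.sum_range_succ, ih, Finset.sum_range_succ, differenceBasis, smul_sub,
      smul_single_one, smul_single_one, ← tailSum_sub_succ N x, lp.single_sub]
    abel

theorem isBasisWithConstant_difference : IsBasisWithConstant tailSum differenceBasis 3 where
  biorthogonal j k := by
    cases k with
    | zero => simp [differenceBasis, tailSum_single]
    | succ k =>
      rw [differenceBasis, map_sub, tailSum_single, tailSum_single]
      split_ifs <;> first | omega | simp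
  bound_nonneg := by norm_num
  norm_sum_le N x := by
    rw [sum_difference]
    refine (norm_add_le _ _).trans ?_
    have h1 : ‖∑ k ∈ Finset.range N, (lp.single 1 k (x k) : lp (fun _ : ℕ => ℂ) 1)‖ ≤ ‖x‖ := by
      refine (norm_sum_le _ _).trans ?_
      simp_rw [lp.norm_single one_pos]
      exact sum_norm_le_l1 x _
    rw [lp.norm_single one_pos]
    linarith [norm_tailSum_le N x]
  tendsto x := by
    simp_rw [sum_difference]
    have h1 := (lp.hasSum_single (p := 1) (by simp) x).tendsto_sum_nat
    have h2 : Tendsto (fun N => (lp.single 1 N (tailSum N x) : lp (fun _ : ℕ => ℂ) 1)) atTop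
        (𝓝 0) := by
      rw [tendsto_zero_iff_norm_tendsto_zero]
      simp_rw [lp.norm_single one_pos]
      exact tendsto_zero_iff_norm_tendsto_zero.mp (tendsto_tailSum x)
    simpa using h1.add h2

/-- The coefficients of the Riesz products for `ℓ¹`; they are square summable. -/
noncomputable def l1Coeff (j : ℕ) : ℝ := ((j : ℝ) + 1) ^ (-(3 / 4) : ℝ)

/-- The tail sums of the weights for `ℓ¹`. -/
noncomputable def l1Tail (j : ℕ) : ℝ := ((j : ℝ) + 1) ^ (-(1 / 4) : ℝ)

/-- The weights of the right-hand side for `ℓ¹`. -/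
noncomputable def l1Weight (j : ℕ) : ℝ := l1Tail j - l1Tail (j + 1)

theorem l1Coeff_mem (j : ℕ) : l1Coeff j ∈ Icc (0 : ℝ) 1 := by
  refine ⟨by unfold l1Coeff; positivity, ?_⟩
  exact Real.rpow_le_one_of_one_le_of_nonpos (by linarith [(Nat.cast_nonneg j : (0 : ℝ) ≤ j)])
    (by norm_num)

theorem summable_l1Coeff_sq : Summable fun j => l1Coeff j ^ 2 := by
  have h1 : Summable fun n : ℕ => (n : ℝ) ^ (-(3 / 2) : ℝ) :=
    Real.summable_nat_rpow.mpr (by norm_num)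
  refine ((summable_nat_add_iff 1).mpr h1).congr fun n => ?_
  rw [l1Coeff, ← Real.rpow_natCast, ← Real.rpow_mul (by positivity)]
  push_cast
  norm_num

theorem l1Tail_antitone (j : ℕ) : l1Tail (j + 1) ≤ l1Tail j := by
  refine Real.rpow_le_rpow_of_nonpos (by positivity) ?_ (by norm_num)
  push_cast
  linarith

theorem l1Weight_nonneg (j : ℕ) : 0 ≤ l1Weight j := sub_nonneg.mpr (l1Tail_antitone j)

theorem l1Tail_nonneg (j : ℕ) : 0 ≤ l1Tail j := by unfold l1Tail; positivity

theorem tendsto_l1Tail : Tendsto l1Tail atTop (𝓝 0) := by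
  have h1 : Tendsto (fun n : ℕ => (n : ℝ) + 1) atTop atTop :=
    tendsto_natCast_atTop_atTop.atTop_add tendsto_const_nhds
  exact (tendsto_rpow_neg_atTop (by norm_num : (0 : ℝ) < 1 / 4)).comp h1

theorem hasSum_l1Weight_ite (n : ℕ) :
    HasSum (fun k => if n ≤ k then l1Weight k else 0) (l1Tail n) := by
  rw [hasSum_iff_tendsto_nat_of_nonneg fun k => by
    split_ifs
    exacts [l1Weight_nonneg k, le_rfl]]
  rw [← tendsto_add_atTop_iff_nat n]
  have h : ∀ N, ∑ k ∈ Finset.range (N + n), (if n ≤ k then l1Weight k else 0) =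
      l1Tail n - l1Tail (N + n) := by
    intro N
    induction N with
    | zero =>
      rw [zero_add, sub_self]
      exact Finset.sum_eq_zero fun k hk => if_neg (not_le.mpr (Finset.mem_range.mp hk))
    | succ N ih =>
      rw [add_right_comm, Finset.sum_range_succ, ih, if_pos (Nat.le_add_left n N), l1Weight]
      ring
  simp_rw [h]
  simpa using tendsto_const_nhds.sub ((tendsto_add_atTop_iff_nat n).mpr tendsto_l1Tail)

theorem hasSum_l1Weight : HasSum l1Weight 1 := by
  simpa [l1Tail] using hasSum_l1Weight_ite 0

/-- The exponents `1 / 4` and `3 / 4` add up to the harmonic exponent, while `2 * (3 / 4) > 1` keeps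
`l1Coeff` square summable. -/
theorem not_summable_l1Tail_mul_l1Coeff : ¬ Summable fun k => l1Tail (k + 1) * l1Coeff k := by
  intro h
  have h1 : Summable fun k : ℕ => ((k + 2 : ℕ) : ℝ)⁻¹ := by
    refine Summable.of_nonneg_of_le (fun k => by positivity) (fun k => ?_) h
    have h2 : ((k + 2 : ℕ) : ℝ) ^ (-(3 / 4) : ℝ) ≤ l1Coeff k :=
      Real.rpow_le_rpow_of_nonpos (by positivity) (by push_cast; linarith) (by norm_num)
    have h3 : l1Tail (k + 1) = ((k + 2 : ℕ) : ℝ) ^ (-(1 / 4) : ℝ) := by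
      rw [l1Tail]
      congr 1
      push_cast
      ring
    rw [h3]
    refine le_trans (le_of_eq ?_) (mul_le_mul_of_nonneg_left h2 (by positivity))
    rw [← Real.rpow_add (by positivity), ← Real.rpow_neg_one]
    norm_num
  exact Real.not_summable_natCast_inv ((summable_nat_add_iff 2).mp h1)

/-- The product of `1 + b j ^ 2` is at most `exp (∑ b j ^ 2)`; since the modulus is at least `1`, it
is bounded by its own square. -/
theorem exists_norm_riesz_l1Coeff_sub_one_le :
    ∃ R : ℝ, 0 ≤ R ∧ ∀ n t, ‖riesz l1Coeff n t - 1‖ ≤ R := by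
  refine ⟨Real.exp (∑' j, l1Coeff j ^ 2) + 1, by positivity, fun n t => ?_⟩
  have h1 : ‖riesz l1Coeff n t‖ ^ 2 ≤ Real.exp (∑' j, l1Coeff j ^ 2) := by
    refine (norm_riesz_sq_le l1Coeff n t).trans ?_
    refine (Finset.prod_le_prod (fun _ _ => by positivity) fun j _ =>
      (add_comm 1 (l1Coeff j ^ 2)).trans_le (Real.add_one_le_exp (l1Coeff j ^ 2))).trans ?_
    rw [← Real.exp_sum, Real.exp_le_exp]
    exact summable_l1Coeff_sq.sum_le_tsum _ fun _ _ => sq_nonneg _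
  have h2 := one_le_norm_riesz l1Coeff n t
  have h3 := norm_sub_le (riesz l1Coeff n t) 1
  rw [norm_one] at h3
  nlinarith

/-- The right-hand side for `ℓ¹`. -/
noncomputable def l1Fun (t : ℝ) : lp (fun _ : ℕ => ℂ) 1 :=
  ∑' k, lp.single 1 k (l1Weight k * (riesz l1Coeff k t - 1))

theorem not_maximalRegularityProperty_l1 :
    ¬ MaximalRegularityProperty (lp (fun _ : ℕ => ℂ) 1) := by
  obtain ⟨R, hR0, hR⟩ := exists_norm_riesz_l1Coeff_sub_one_le
  have hbound : ∀ k t, ‖(l1Weight k : ℂ) * (riesz l1Coeff k t - 1)‖ ≤ l1Weight k * R := by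
    intro k t
    rw [norm_mul, Complex.norm_real, Real.norm_of_nonneg (l1Weight_nonneg k)]
    exact mul_le_mul_of_nonneg_left (hR k t) (l1Weight_nonneg k)
  have hbound' : ∀ k t, ‖(lp.single 1 k ((l1Weight k : ℂ) * (riesz l1Coeff k t - 1)) :
      lp (fun _ : ℕ => ℂ) 1)‖ ≤ l1Weight k * R := fun k t => by
    rw [lp.norm_single one_pos]
    exact hbound k t
  have hsumR : HasSum (fun k => l1Weight k * R) (1 * R) := hasSum_l1Weight.mul_right R
  have hterm : ∀ k, Continuous fun t => (l1Weight k : ℂ) * (riesz l1Coeff k t - 1) := fun k =>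
    continuous_const.mul ((continuous_riesz l1Coeff k).sub continuous_const)
  have hcont : Continuous l1Fun :=
    continuous_tsum (fun k => (lp.isometry_single k).continuous.comp (hterm k)) hsumR.summable
      hbound'
  have htail : ∀ n t, tailSum n (l1Fun t) =
      ∑' k, if n ≤ k then (l1Weight k : ℂ) * (riesz l1Coeff k t - 1) else 0 := by
    intro n t
    have h1 : Summable fun k => (lp.single 1 k ((l1Weight k : ℂ) * (riesz l1Coeff k t - 1)) :
        lp (fun _ : ℕ => ℂ) 1) := Summable.of_norm_bounded hsumR.summable fun k => hbound' k t
    rw [l1Fun, ContinuousLinearMap.map_tsum _ h1]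
    simp_rw [tailSum_single]
  -- The filter turns each `riesz k` with `k ≥ n` into `riesz n`, with an error independent of `k`.
  -- The surviving weights add up to `l1Tail n`, and the errors are averaged against weights of
  -- total mass `1`.
  have hrelax : ∀ n, ∀ t, 0 ≤ t → ‖relax (rate n) (fun s => tailSum n (l1Fun s)) t -
      l1Tail n * (riesz l1Coeff n t - 1)‖ ≤ 12 * (1 / 4) ^ n := by
    intro n t ht
    simp_rw [htail]
    have h1 := hasSum_relax (lam := rate n) (u := fun k => l1Weight k * R)
      (h := fun k s => if n ≤ k then (l1Weight k : ℂ) * (riesz l1Coeff k s - 1) else 0)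
      (fun k => by
        split_ifs
        exacts [hterm k, continuous_const]) hsumR.summable (fun k s => by
        split_ifs
        · exact hbound k s
        · rw [norm_zero]
          exact mul_nonneg (l1Weight_nonneg k) hR0) t
    have h2 : HasSum (fun k => (((if n ≤ k then l1Weight k else 0 : ℝ)) : ℂ) *
        (riesz l1Coeff n t - 1)) (l1Tail n * (riesz l1Coeff n t - 1)) :=
      (Complex.hasSum_ofReal.mpr (hasSum_l1Weight_ite n)).mul_right _
    have h3 := h1.sub h2
    have h4 : HasSum (fun k => l1Weight k * (12 * (1 / 4 : ℝ) ^ n)) (1 * (12 * (1 / 4) ^ n)) :=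
      hasSum_l1Weight.mul_right _
    rw [← h3.tsum_eq, ← one_mul (12 * (1 / 4 : ℝ) ^ n)]
    refine tsum_of_norm_bounded h4 fun k => ?_
    by_cases hk : n ≤ k
    · simp only [if_pos hk]
      rw [relax_const_mul, ← mul_sub, norm_mul, Complex.norm_real,
        Real.norm_of_nonneg (l1Weight_nonneg k)]
      exact mul_le_mul_of_nonneg_left (norm_relax_riesz_sub_le l1Coeff_mem hk ht)
        (l1Weight_nonneg k)
    · simp only [if_neg hk]
      have : relax (rate n) (fun _ => 0) t = 0 := by simp [relax]
      rw [this, Complex.ofReal_zero, zero_mul, sub_zero, norm_zero]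
      exact mul_nonneg (l1Weight_nonneg k) (by positivity)
  refine isBasisWithConstant_difference.not_maximalRegularityProperty isExponentSequence_rate
    (f := l1Fun) (M := 1 * R) hcont (fun t => tsum_of_norm_bounded hsumR fun k => hbound' k t) ?_
  intro T hT hae
  refine not_summable_l1Tail_mul_l1Coeff (summable_of_ae_bounded_sin_sq
    (fun k => mul_nonneg (l1Tail_nonneg _) (l1Coeff_mem k).1) hT ?_)
  filter_upwards [hae, self_mem_ae_restrict measurableSet_Ico] with t ⟨y, hy⟩ htT
  -- `48` is the sum of the errors `24 * (1 / 2) ^ k`, where `24 = 12 + 12` comes from applying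
  -- `hrelax` at `k` and at `k + 1`.
  refine ⟨‖y‖ + R + 48, fun N => ?_⟩
  have hstep : ∀ k, l1Tail (k + 1) * l1Coeff k * Real.sin (freq k * t) ^ 2 ≤
      ‖y k‖ + l1Weight k * R + 24 * (1 / 2) ^ k := by
    intro k
    have h1 := hrelax k t htT.1
    have h2 := hrelax (k + 1) t htT.1
    rw [← hy] at h1 h2
    -- Discrete product rule for `l1Tail k * (riesz k - 1)`: the difference of tail sums is an entry
    -- of `y`, the weight term is summable, and the last two brackets are filtering errors.
    have h3 : (l1Tail (k + 1) : ℂ) * rieszIncr l1Coeff k t =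
        (tailSum (k + 1) y - tailSum k y) + (l1Weight k : ℂ) * (riesz l1Coeff k t - 1) +
        (tailSum k y - l1Tail k * (riesz l1Coeff k t - 1)) -
        (tailSum (k + 1) y - l1Tail (k + 1) * (riesz l1Coeff (k + 1) t - 1)) := by
      rw [riesz_succ, l1Weight]
      push_cast
      ring
    have h4 : l1Tail (k + 1) * l1Coeff k * Real.sin (freq k * t) ^ 2 ≤
        ‖(l1Tail (k + 1) : ℂ) * rieszIncr l1Coeff k t‖ := by
      rw [norm_mul, Complex.norm_real, Real.norm_of_nonneg (l1Tail_nonneg _),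
        norm_rieszIncr (l1Coeff_mem k).1, mul_assoc]
      refine mul_le_mul_of_nonneg_left (mul_le_mul_of_nonneg_left ?_ (l1Coeff_mem k).1)
        (l1Tail_nonneg _)
      -- Here `sin ^ 2 ≤ |sin| ≤ |sin| * ‖riesz‖`, because the Riesz product has modulus at least
      -- `1`.
      rw [← sq_abs]
      have h5 := Real.abs_sin_le_one (freq k * t)
      nlinarith [abs_nonneg (Real.sin (freq k * t)), one_le_norm_riesz l1Coeff k t]
    have h6 : ‖tailSum (k + 1) y - tailSum k y‖ = ‖y k‖ := by
      rw [norm_sub_rev, tailSum_sub_succ]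
    have h7 : ((1 : ℝ) / 4) ^ k ≤ (1 / 2) ^ k := pow_le_pow_left₀ (by norm_num) (by norm_num) k
    have h8 : ((1 : ℝ) / 4) ^ (k + 1) ≤ (1 / 4) ^ k :=
      pow_le_pow_of_le_one (by norm_num) (by norm_num) k.le_succ
    rw [h3] at h4
    refine h4.trans ((norm_sub_le _ _).trans ((add_le_add ((norm_add_le _ _).trans (add_le_add
      ((norm_add_le _ _).trans (add_le_add h6.le (hbound k t))) h1)) h2).trans ?_))
    linarith
  refine (Finset.sum_le_sum fun k _ => hstep k).trans ?_
  rw [Finset.sum_add_distrib, Finset.sum_add_distrib, ← Finset.mul_sum]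
  have i1 := sum_norm_le_l1 y (Finset.range N)
  have i2 := sum_le_hasSum (Finset.range N)
    (fun k _ => mul_nonneg (l1Weight_nonneg k) hR0) hsumR
  have i3 := Summable.sum_le_tsum (Finset.range N) (fun _ _ => by positivity)
    summable_geometric_two
  rw [tsum_geometric_two] at i3
  linarith

end Summing

end MaximalRegularity

theorem corollary3p2 :
    ¬ MaximalRegularity.MaximalRegularityProperty C₀(ℕ, ℂ) ∧
      ¬ MaximalRegularity.MaximalRegularityProperty (lp (fun _ : ℕ => ℂ) 1) := by
  exact ⟨MaximalRegularity.not_maximalRegularityProperty_c0,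
    MaximalRegularity.not_maximalRegularityProperty_l1⟩
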